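/- Let $N\ge 1$ identical players have parameters $\lambda,\gamma,p>0$ and let $1\le u_{\min}<u_{\max}<\infty$. A strategy of a player is a piecewise continuous control $u_i:[0,\infty)\to[u_{\min},u_{\max}]$ (finitely many jumps in every bounded interval, with one-sided limits). A strategy profile $(u_1,\dots,u_N)$ determines $x_1,\dots,x_N$ by $$\dot x_i=\lambda u_i(1-x),\qquad x=\sum_{j}x_j,\qquad x_i(0)=z_i,$$ with given initial values $z_i\ge 0$, $\sum_i z_i\le 1$ (for instance $z_i=0$), and player $i$ minimizes $$J_i=\int_0^\infty e^{-ps}\bigl(-\dot x_i(s)+\gamma(u_i(s)-u_{\min})\bigr)\,ds .$$ A profile is a Nash equilibrium if no player can lower the own cost by replacing the own control with another one while the controls of the others stay the same; it is symmetric if all players use the same control. Assume $\lambda\Bigl(1-\dfrac{\lambda u_{\min}}{p+N\lambda u_{\min}}\Bigr)-\gamma>0$ and put $$x^*=1-\frac{\gamma\,(p+N\lambda u_{\min})}{\lambda\,(p+(N-1)\lambda u_{\min})}.$$ Then $0<x^*<1$. Let $\varphi$ be a threshold law with threshold $x^*$, that is, $\varphi(x)=u_{\max}$ for $x<x^*$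 and $\varphi(x)=u_{\min}$ for $x>x^*$ (with any value in $[u_{\min},u_{\max}]$ at $x^*$). Then: 1. There is a control $u$ such that, when all players use it, $u(t)=\varphi(x(t))$ for all $t\ge 0$, and the profile $(u,\dots,u)$ is a Nash equilibrium. It is the unique symmetric Nash equilibrium: if $(v,\dots,v)$ is a Nash equilibrium, then $v(t)=u(t)$ for every $t\ge0$ at which $u$ and $v$ are both continuous. 2. The law $\varphi$ is also a best reply to itself as a feedback law: if all players other than $i$ play $u_j(t)=\varphi(x(t))$, and so react to the actual state, then no control of player $i$ gives a lower cost $J_i$ than playing $u_i(t)=\varphi(x(t))$ too. -/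

import Mathlib

open Set Filter Topology MeasureTheory

/-- Data of the content-diffusion game with `N` players: view intensities `lam i`, acceleration
costs `gam i`, discount factors `p i`, the range `[umin, umax]` of accelerations, and the initial
fractions `z i` of viewers of each content. -/
structure ContentGame (N : ℕ) where
  lam : Fin N → ℝ
  gam : Fin N → ℝ
  p : Fin N → ℝ
  umin : ℝ
  umax : ℝ
  z : Fin N → ℝ

/-- Piecewise continuity on `[0, ∞)`: finitely many discontinuities in every bounded interval, and
(finite) one-sided limits everywhere. Values at negative times are irrelevant. -/
structure IsPiecewiseContinuous (f : ℝ → ℝ) : Prop where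
  finite_jumps : ∀ T : ℝ, {t ∈ Icc 0 T | ¬ ContinuousWithinAt f (Ici 0) t}.Finite
  left_limit : ∀ t : ℝ, 0 < t → ∃ l : ℝ, Tendsto f (𝓝[<] t) (𝓝 l)
  right_limit : ∀ t : ℝ, 0 ≤ t → ∃ l : ℝ, Tendsto f (𝓝[>] t) (𝓝 l)

namespace ContentGame

variable {N : ℕ}

/-- The strategy space: piecewise continuous controls `[0, ∞) → [umin, umax]`. -/
def controls (G : ContentGame N) : Set (ℝ → ℝ) :=
  {u | IsPiecewiseContinuous u ∧ ∀ t : ℝ, 0 ≤ t → u t ∈ Icc G.umin G.umax}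

/-- The total fraction of viewers who have accessed some content at time `t`. -/
def total (x : Fin N → ℝ → ℝ) (t : ℝ) : ℝ := ∑ j, x j t

/-- The right-hand side `lam i * u i * (1 - x)` of the equation of motion of content `i`. -/
def rate (G : ContentGame N) (u x : Fin N → ℝ → ℝ) (i : Fin N) (t : ℝ) : ℝ :=
  G.lam i * u i t * (1 - total x t)

/-- `x` solves `x i' = lam i * u i * (1 - ∑ j, x j)`, `x i 0 = z i` on `[0, ∞)`, in integrated form
(the controls may jump). -/
structure IsTrajectory (G : ContentGame N) (u x : Fin N → ℝ → ℝ) : Prop where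
  continuousOn : ∀ i, ContinuousOn (x i) (Ici 0)
  eq_integral : ∀ i, ∀ t : ℝ, 0 ≤ t → x i t = G.z i + ∫ s in (0 : ℝ)..t, G.rate u x i s

/-- The discounted cost of player `i` along a trajectory `x` for the controls `u`,
`∫₀^∞ e^{-p i s} (-x i' + gam i * (u i - umin)) ds`, where `x i' = rate i`. -/
noncomputable def cost (G : ContentGame N) (u x : Fin N → ℝ → ℝ) (i : Fin N) : ℝ :=
  ∫ s in Ioi (0 : ℝ),
    Real.exp (-(G.p i * s)) * (-(G.rate u x i s) + G.gam i * (u i s - G.umin))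

/-- Nash equilibrium of the game whose strategies are the controls: no player can lower the own
cost by replacing the own control with another one. -/
def IsNash (G : ContentGame N) (u : Fin N → ℝ → ℝ) : Prop :=
  (∀ i, u i ∈ G.controls) ∧
  ∀ x, G.IsTrajectory u x →
    ∀ i, ∀ v ∈ G.controls, ∀ x', G.IsTrajectory (Function.update u i v) x' →
      G.cost u x i ≤ G.cost (Function.update u i v) x' i

/-- The pair `(u, x)` results from player `j` following the state-feedback law `φ j`. -/
def Follows (φ : ℝ → ℝ) (u x : Fin N → ℝ → ℝ) (j : Fin N) : Prop :=
  ∀ t : ℝ, 0 ≤ t → u j t = φ (total x t)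

/-- Equilibrium of feedback laws: when the opponents of player `i` keep following their laws (so
that they react to the state changed by a deviation), no control of player `i` has a lower cost
than following the law `φ i`. -/
def IsFeedbackNash (G : ContentGame N) (φ : Fin N → ℝ → ℝ) : Prop :=
  ∀ u x, G.IsTrajectory u x → (∀ j, Follows (φ j) u x j) →
    ∀ i, ∀ w x', G.IsTrajectory w x' → w i ∈ G.controls →
      (∀ j, j ≠ i → Follows (φ j) w x' j) →
        G.cost u x i ≤ G.cost w x' i

/-- Threshold law with threshold `c`: `umax` below `c` and `umin` above `c`; at `c` itself any
admissible value is allowed. -/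
def IsThresholdLaw (G : ContentGame N) (c : ℝ) (φ : ℝ → ℝ) : Prop :=
  (∀ x, x < c → φ x = G.umax) ∧ (∀ x, c < x → φ x = G.umin) ∧ φ c ∈ Icc G.umin G.umax

/-- The game with identical players. -/
def identical (N : ℕ) (lam gam p umin umax : ℝ) (z : Fin N → ℝ) : ContentGame N where
  lam := fun _ => lam
  gam := fun _ => gam
  p := fun _ => p
  umin := umin
  umax := umax
  z := z

end ContentGame

/-!
Write `y = 1 - ∑ x_j` for the fraction of viewers still to be reached, so that
`y' = -lam (∑ u_j) y` and `y = y₀ exp (-∫ lam ∑ u_j)`.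

**Open loop.** If the other players keep `u` and one player deviates to `v`, then, after integration
by parts, the cost becomes a convex functional of the cumulated acceleration of the deviating
player. `playerCost_sub_playerCost` gives the cost difference exactly: its linear part is
`∫ e^{-ps} (gam - lam Φ) (v - u)`, where the marginal value
`Φ t = (n - 1) / n * y t + p / n * ∫₀^∞ e^{-pr} y (t + r) dr` depends on the state only, and the
rest is nonnegative and quadratic for small deviations. Hence `(u, …, u)` is an equilibrium if and only
if `u` maximizes `(lam Φ - gam) u` almost everywhere (`playerCost_le_of_first_order`,
`first_order_of_playerCost_le`).

As `y` decays exponentially, so does `Φ`, and an equilibrium control switches once, from `umax` to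
`umin`. After the switch `y` decays at the constant rate `n lam umin` and `Φ` is a constant multiple
of `y`, which turns the condition `lam Φ = gam` at the switch into `y = 1 - x*`. So every symmetric
equilibrium control obeys the threshold law (`ContentGame.IsNash.ae_eq_thresholdLaw`), and
conversely the control generated by the law satisfies the first-order condition
(`ContentGame.exists_isNash_of_thresholdLaw`). Two such controls coincide almost everywhere, by a
comparison principle for `y' = -n lam φ(1 - y) y`, whose right-hand side is antitone in `y`
(`ThresholdSetting.state_le_state`).

**Feedback.** When the opponents follow the law, the state still decreases and crosses the threshold
at most once (`ContentGame.subsingleton_crossing`). The candidate value function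
`thresholdValue` may have a kink at the threshold, but its composition with the state is continuous
and differentiable off a countable set, so that the Hamilton–Jacobi–Bellman inequality
(`hamiltonJacobiBellman`), which is an equality along the law itself, can be integrated in time
(`verification`).

All integrands lie in the class `IsTame` of functions with countably many discontinuities and
polynomial growth, for which the fundamental theorem of calculus with countable exceptional set
applies.
-/

/-! ### Tame functions on the half-line -/

/-- Functions on `[0, ∞)` with at most countably many discontinuities and polynomial growth: the
class in which all integrands live. Every control is tame, the class is closed under sums,
products and primitives, and exponentially discounted tame functions are integrable. Values at
negative times are irrelevant. -/
structure IsTame (f : ℝ → ℝ) : Prop where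
  countable_disc : {t | 0 < t ∧ ¬ ContinuousAt f t}.Countable
  growth : ∃ C : ℝ, ∃ k : ℕ, ∀ t, 0 ≤ t → |f t| ≤ C * (1 + t) ^ k

namespace IsTame

variable {f g : ℝ → ℝ}

lemma of_continuousOn_of_bound (hf : ContinuousOn f (Ici 0)) {C : ℝ}
    (hC : ∀ t, 0 ≤ t → |f t| ≤ C) : IsTame f := by
  refine ⟨?_, C, 0, by simpa using hC⟩
  convert countable_empty
  ext t
  simp only [mem_ofPred_eq, mem_empty_iff_false, iff_false, not_and, not_not]
  exact fun ht => hf.continuousAt (Ici_mem_nhds ht)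

lemma const (c : ℝ) : IsTame (fun _ => c) :=
  of_continuousOn_of_bound continuousOn_const (C := |c|) (fun _ _ => le_rfl)

lemma exists_growth (hf : IsTame f) :
    ∃ C : ℝ, 0 ≤ C ∧ ∃ k : ℕ, ∀ t, 0 ≤ t → |f t| ≤ C * (1 + t) ^ k := by
  obtain ⟨C, k, h⟩ := hf.growth
  refine ⟨C, ?_, k, h⟩
  have := h 0 le_rfl
  simp only [add_zero, one_pow, mul_one] at this
  exact (abs_nonneg _).trans this

lemma mul (hf : IsTame f) (hg : IsTame g) : IsTame (fun t => f t * g t) := by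
  refine ⟨(hf.countable_disc.union hg.countable_disc).mono ?_, ?_⟩
  · rintro t ⟨ht, h⟩
    by_contra hc
    simp only [mem_union, mem_ofPred_eq, not_or, not_and, not_not] at hc
    exact h ((hc.1 ht).mul (hc.2 ht))
  · obtain ⟨C, hC, k, h⟩ := hf.exists_growth
    obtain ⟨C', hC', k', h'⟩ := hg.exists_growth
    refine ⟨C * C', k + k', fun t ht => ?_⟩
    rw [abs_mul, pow_add]
    calc _ ≤ (C * (1 + t) ^ k) * (C' * (1 + t) ^ k') :=
          mul_le_mul (h t ht) (h' t ht) (abs_nonneg _) (by positivity)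
      _ = _ := by ring

lemma add (hf : IsTame f) (hg : IsTame g) : IsTame (fun t => f t + g t) := by
  refine ⟨(hf.countable_disc.union hg.countable_disc).mono ?_, ?_⟩
  · rintro t ⟨ht, h⟩
    by_contra hc
    simp only [mem_union, mem_ofPred_eq, not_or, not_and, not_not] at hc
    exact h ((hc.1 ht).add (hc.2 ht))
  · obtain ⟨C, hC, k, h⟩ := hf.exists_growth
    obtain ⟨C', hC', k', h'⟩ := hg.exists_growth
    refine ⟨C + C', k + k', fun t ht => (abs_add_le _ _).trans ?_⟩
    have h1 : (1 + t) ^ k ≤ (1 + t) ^ (k + k') := pow_le_pow_right₀ (by linarith) (by omega)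
    have h2 : (1 + t) ^ k' ≤ (1 + t) ^ (k + k') := pow_le_pow_right₀ (by linarith) (by omega)
    have := h t ht
    have := h' t ht
    nlinarith [mul_le_mul_of_nonneg_left h1 hC, mul_le_mul_of_nonneg_left h2 hC']

lemma const_mul (hf : IsTame f) (c : ℝ) : IsTame (fun t => c * f t) := (const c).mul hf

lemma neg (hf : IsTame f) : IsTame (fun t => -f t) := by simpa using hf.const_mul (-1)

lemma sub (hf : IsTame f) (hg : IsTame g) : IsTame (fun t => f t - g t) := by
  simpa [sub_eq_add_neg] using hf.add hg.neg

lemma sum {ι : Type*} (s : Finset ι) {F : ι → ℝ → ℝ} (h : ∀ i ∈ s, IsTame (F i)) :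
    IsTame (fun t => ∑ i ∈ s, F i t) := by
  classical
  induction s using Finset.induction_on with
  | empty => simpa using const 0
  | insert a s ha ih =>
    simp only [Finset.sum_insert ha]
    exact (h a (by simp)).add (ih fun i hi => h i (by simp [hi]))

lemma congr (hf : IsTame f) (h : ∀ t, 0 ≤ t → g t = f t) : IsTame g := by
  refine ⟨hf.countable_disc.mono ?_, ?_⟩
  · rintro t ⟨ht, h'⟩
    refine ⟨ht, fun hc => h' (hc.congr ?_)⟩
    filter_upwards [Ioi_mem_nhds ht] with s hs using (h s (le_of_lt hs)).symm
  · obtain ⟨C, k, hk⟩ := hf.growth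
    exact ⟨C, k, fun t ht => by rw [h t ht]; exact hk t ht⟩

lemma aestronglyMeasurable (hf : IsTame f) :
    AEStronglyMeasurable f (volume.restrict (Ioi 0)) := by
  have hS := hf.countable_disc
  set S := {t | 0 < t ∧ ¬ ContinuousAt f t} with hSdef
  have hc : ContinuousOn f (Ioi 0 \ S) := by
    rintro t ⟨ht, hts⟩
    refine ContinuousAt.continuousWithinAt ?_
    by_contra hc
    exact hts ⟨ht, hc⟩
  have h1 := hc.aestronglyMeasurable (μ := volume) (measurableSet_Ioi.diff hS.measurableSet)
  refine h1.mono_ac ?_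
  have : (volume.restrict (Ioi (0 : ℝ) \ S)) = volume.restrict (Ioi 0) :=
    Measure.restrict_congr_set (sdiff_null_ae_eq_self (hS.measure_zero _))
  rw [this]

lemma intervalIntegrable (hf : IsTame f) {a b : ℝ} (ha : 0 ≤ a) (hb : 0 ≤ b) :
    IntervalIntegrable f volume a b := by
  have key : ∀ b, 0 ≤ b → IntervalIntegrable f volume 0 b := by
    intro b hb
    rw [intervalIntegrable_iff_integrableOn_Ioc_of_le hb]
    obtain ⟨C, hC, k, h⟩ := hf.exists_growth
    refine IntegrableOn.of_bound (by simp)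
      (hf.aestronglyMeasurable.mono_set Ioc_subset_Ioi_self) (C * (1 + b) ^ k) ?_
    filter_upwards [ae_restrict_mem measurableSet_Ioc] with t ht
    have h0 : 0 ≤ t := ht.1.le
    refine (h t h0).trans ?_
    gcongr
    exact ht.2
  exact (key a ha).symm.trans (key b hb)

lemma continuousOn_primitive (hf : IsTame f) :
    ContinuousOn (fun t => ∫ s in (0 : ℝ)..t, f s) (Ici 0) := by
  intro t ht
  have ht' : (0 : ℝ) ≤ t := ht
  have h1 : ContinuousOn (fun t => ∫ s in (0 : ℝ)..t, f s) (Icc 0 (t + 1)) := by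
    have := intervalIntegral.continuousOn_primitive_interval' (a := 0)
      (hf.intervalIntegrable le_rfl (show 0 ≤ t + 1 by linarith)) (by simp)
    rwa [uIcc_of_le (by linarith)] at this
  refine (h1 t ⟨ht', by linarith⟩).mono_of_mem_nhdsWithin ?_
  rw [mem_nhdsWithin]
  exact ⟨Iio (t + 1), isOpen_Iio, by simp, fun s hs => ⟨hs.2, hs.1.le⟩⟩

lemma hasDerivAt_primitive (hf : IsTame f) {t : ℝ} (ht : 0 < t) (hc : ContinuousAt f t) :
    HasDerivAt (fun t => ∫ s in (0 : ℝ)..t, f s) (f t) t :=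
  intervalIntegral.integral_hasDerivAt_right (hf.intervalIntegrable le_rfl ht.le)
    ⟨Ioi 0, Ioi_mem_nhds ht, hf.aestronglyMeasurable⟩ hc

lemma primitive (hf : IsTame f) : IsTame (fun t => ∫ s in (0 : ℝ)..t, f s) := by
  refine ⟨?_, ?_⟩
  · convert countable_empty
    ext t
    simp only [mem_ofPred_eq, mem_empty_iff_false, iff_false, not_and, not_not]
    exact fun ht => hf.continuousOn_primitive.continuousAt (Ici_mem_nhds ht)
  · obtain ⟨C, hC, k, h⟩ := hf.exists_growth
    refine ⟨C, k + 1, fun t ht => ?_⟩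
    have := intervalIntegral.norm_integral_le_of_norm_le_const (a := 0) (b := t) (f := f)
      (C := C * (1 + t) ^ k) (fun s hs => by
        rw [uIoc_of_le ht] at hs
        refine (h s hs.1.le).trans ?_
        have : 0 ≤ s := hs.1.le
        gcongr
        exact hs.2)
    rw [Real.norm_eq_abs, sub_zero, abs_of_nonneg ht] at this
    refine this.trans ?_
    rw [pow_succ, ← mul_assoc]
    gcongr
    linarith

lemma exp_neg (hf : IsTame f) (h0 : ∀ t, 0 ≤ t → 0 ≤ f t) :
    IsTame (fun t => Real.exp (-f t)) := by
  refine ⟨hf.countable_disc.mono ?_, 1, 0, fun t ht => ?_⟩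
  · rintro t ⟨ht, h⟩
    exact ⟨ht, fun hc => h (Real.continuous_exp.continuousAt.comp hc.neg)⟩
  · rw [abs_of_pos (Real.exp_pos _)]
    simpa using h0 t ht

end IsTame

lemma tendsto_one_add_pow_mul_exp_neg {p : ℝ} (hp : 0 < p) (k : ℕ) :
    Tendsto (fun t : ℝ => Real.exp (-(p * t)) * (1 + t) ^ k) atTop (𝓝 0) := by
  have h1 := (Real.tendsto_pow_mul_exp_neg_atTop_nhds_zero k).comp
    (tendsto_id.const_mul_atTop hp)
  have h2 : Tendsto (fun t : ℝ => (2 / p) ^ k * ((p * t) ^ k * Real.exp (-(p * t)))) atTop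
      (𝓝 0) := by
    simpa using h1.const_mul ((2 / p) ^ k)
  refine squeeze_zero' ?_ ?_ h2
  · filter_upwards [eventually_ge_atTop 0] with t ht
    positivity
  · filter_upwards [eventually_ge_atTop 1] with t ht
    have : (1 + t) ^ k ≤ (2 / p) ^ k * (p * t) ^ k := by
      rw [← mul_pow]
      have : 2 / p * (p * t) = 2 * t := by field_simp
      rw [this]
      gcongr
      linarith
    have := mul_le_mul_of_nonneg_left this (Real.exp_pos (-(p * t))).le
    linarith

namespace IsTame

variable {f g : ℝ → ℝ}

lemma tendsto_discounted (hf : IsTame f) {p : ℝ} (hp : 0 < p) :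
    Tendsto (fun t => Real.exp (-(p * t)) * f t) atTop (𝓝 0) := by
  obtain ⟨C, hC, k, h⟩ := hf.exists_growth
  have h2 := (tendsto_one_add_pow_mul_exp_neg hp k).const_mul C
  rw [mul_zero] at h2
  refine squeeze_zero_norm' ?_ h2
  filter_upwards [eventually_ge_atTop 0] with t ht
  rw [norm_mul, Real.norm_eq_abs, Real.norm_eq_abs, abs_of_pos (Real.exp_pos _)]
  have := mul_le_mul_of_nonneg_left (h t ht) (Real.exp_pos (-(p * t))).le
  linarith

lemma integrableOn_discounted (hf : IsTame f) {p : ℝ} (hp : 0 < p) :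
    IntegrableOn (fun t => Real.exp (-(p * t)) * f t) (Ioi 0) := by
  -- half of the discounting absorbs the polynomial growth, the other half makes it integrable
  have hp2 : 0 < p / 2 := by linarith
  obtain ⟨C, hC, k, h⟩ := hf.exists_growth
  have hdom : IntegrableOn (fun t : ℝ => Real.exp (-(p * t)) * (1 + t) ^ k) (Ioi 0) := by
    refine integrable_of_isBigO_exp_neg hp2 (by fun_prop) ?_
    have h1 : (fun t : ℝ => Real.exp (-(p / 2 * t)) * (1 + t) ^ k) =O[atTop] (fun _ => (1 : ℝ)) :=
      (tendsto_one_add_pow_mul_exp_neg hp2 k).isBigO_one ℝ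
    have h2 := (Asymptotics.isBigO_refl (fun t : ℝ => Real.exp (-(p / 2) * t)) atTop).mul h1
    refine (h2.congr (fun t => ?_) (fun t => ?_))
    · rw [← mul_assoc, ← Real.exp_add]
      congr 2
      ring
    · simp
  refine Integrable.mono' (hdom.const_mul C) ?_ ?_
  · exact (by fun_prop : Continuous fun t : ℝ => Real.exp (-(p * t))).aestronglyMeasurable.mul
      hf.aestronglyMeasurable
  · filter_upwards [ae_restrict_mem measurableSet_Ioi] with t ht
    rw [norm_mul, Real.norm_eq_abs, Real.norm_eq_abs, abs_of_pos (Real.exp_pos _)]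
    have := mul_le_mul_of_nonneg_left (h t (le_of_lt ht)) (Real.exp_pos (-(p * t))).le
    linarith

/-- Integration of a discounted total derivative: the boundary term at infinity vanishes, and
countably many times without derivative do not matter. -/
lemma integral_discounted_deriv {F f : ℝ → ℝ} {p : ℝ} (hp : 0 < p) (hF : IsTame F)
    (hFc : ContinuousOn F (Ici 0)) (hf : IsTame f) {S : Set ℝ} (hS : S.Countable)
    (hd : ∀ t, 0 < t → t ∉ S → HasDerivAt F (f t) t) :
    ∫ t in Ioi (0 : ℝ), Real.exp (-(p * t)) * (f t - p * F t) = -F 0 := by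
  have hfp : IsTame (fun t => f t - p * F t) := hf.sub (hF.const_mul p)
  have h1 := intervalIntegral_tendsto_integral_Ioi (0 : ℝ) (hfp.integrableOn_discounted hp)
    tendsto_id
  have h2 : Tendsto (fun t => Real.exp (-(p * t)) * F t - F 0) atTop (𝓝 (0 - F 0)) :=
    (hF.tendsto_discounted hp).sub_const _
  rw [zero_sub] at h2
  refine tendsto_nhds_unique h1 (h2.congr' ?_)
  filter_upwards [eventually_ge_atTop 0] with t ht
  symm
  have hexp : Continuous fun t : ℝ => Real.exp (-(p * t)) := by fun_prop
  have := integral_eq_of_hasDerivAt_off_countable_of_le (fun t => Real.exp (-(p * t)) * F t)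
    (fun t => Real.exp (-(p * t)) * (f t - p * F t)) ht hS
    (hexp.continuousOn.mul (hFc.mono Icc_subset_Ici_self)) ?_ ?_
  · simpa using this
  · rintro s ⟨hs, hsS⟩
    have he : HasDerivAt (fun t : ℝ => Real.exp (-(p * t))) (Real.exp (-(p * s)) * -(p * 1)) s :=
      ((hasDerivAt_id s).const_mul p).neg.exp
    exact (he.fun_mul (hd s hs.1 hsS)).congr_deriv (by ring)
  · exact IntervalIntegrable.continuousOn_mul (hfp.intervalIntegrable le_rfl ht) hexp.continuousOn

end IsTame

lemma IsPiecewiseContinuous.isTame {f : ℝ → ℝ} (hf : IsPiecewiseContinuous f) {C : ℝ}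
    (hC : ∀ t, 0 ≤ t → |f t| ≤ C) : IsTame f := by
  refine ⟨?_, C, 0, by simpa using hC⟩
  have : (⋃ n : ℕ, {t ∈ Icc (0 : ℝ) n | ¬ ContinuousWithinAt f (Ici 0) t}).Countable :=
    countable_iUnion fun n => (hf.finite_jumps n).countable
  refine this.mono ?_
  rintro t ⟨ht, h⟩
  obtain ⟨n, hn⟩ := exists_nat_ge t
  exact mem_iUnion.2 ⟨n, ⟨ht.le, hn⟩, fun hc => h (hc.continuousAt (Ici_mem_nhds ht))⟩

/-! ### Linear decay with a variable rate -/

/-- Comparison principle on `[0, ∞)`: if `f` starts below `g` and grows no faster than `g` on every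
interval on which it lies above `g`, then it stays below `g`. -/
lemma le_of_forall_increment_le {f g : ℝ → ℝ} (hf : ContinuousOn f (Ici 0))
    (hg : ContinuousOn g (Ici 0)) (h0 : f 0 ≤ g 0)
    (h : ∀ s t, 0 ≤ s → s < t → (∀ r ∈ Ioc s t, g r < f r) → f t - f s ≤ g t - g s)
    {t : ℝ} (ht : 0 ≤ t) : f t ≤ g t := by
  by_contra! hlt
  -- `s` is the last time before `t` at which `f ≤ g`
  set A := {s | s ∈ Icc 0 t ∧ f s ≤ g s} with hA
  have hcl : IsClosed A :=
    isClosed_Icc.isClosed_le (hf.mono Icc_subset_Ici_self) (hg.mono Icc_subset_Ici_self)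
  have hne : A.Nonempty := ⟨0, ⟨le_rfl, ht⟩, h0⟩
  have hbdd : BddAbove A := ⟨t, fun s hs => hs.1.2⟩
  have hs := hcl.csSup_mem hne hbdd
  set s := sSup A
  have hst : s < t := lt_of_le_of_ne hs.1.2 fun he => by
    have := hs.2
    rw [he] at this
    linarith
  have := h s t hs.1.1 hst fun r hr => by
    by_contra! hc
    have : r ≤ s := le_csSup hbdd ⟨⟨hs.1.1.trans hr.1.le, hr.2⟩, hc⟩
    linarith [hr.1]
  linarith [hs.2]

/-- The solution `y₀ exp (-∫₀ᵗ a)` of `y' = -a y`, `y 0 = y₀`. -/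
noncomputable def decay (y₀ : ℝ) (a : ℝ → ℝ) (t : ℝ) : ℝ :=
  y₀ * Real.exp (-∫ s in (0 : ℝ)..t, a s)

section decay

variable {y₀ k : ℝ} {a b : ℝ → ℝ}

@[simp] lemma decay_zero : decay y₀ a 0 = y₀ := by simp [decay]

lemma decay_nonneg (hy : 0 ≤ y₀) (t : ℝ) : 0 ≤ decay y₀ a t :=
  mul_nonneg hy (Real.exp_pos _).le

lemma continuousOn_decay (ha : IsTame a) : ContinuousOn (decay y₀ a) (Ici 0) :=
  continuousOn_const.mul (Real.continuous_exp.comp_continuousOn ha.continuousOn_primitive.neg)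

lemma hasDerivAt_decay (ha : IsTame a) {t : ℝ} (ht : 0 < t) (hc : ContinuousAt a t) :
    HasDerivAt (decay y₀ a) (-(a t * decay y₀ a t)) t := by
  have := ((ha.hasDerivAt_primitive ht hc).fun_neg.exp).const_mul y₀
  exact this.congr_deriv (by rw [decay]; ring)

lemma decay_congr (hab : ∀ᵐ s ∂volume.restrict (Ioi 0), a s = b s) {t : ℝ} (ht : 0 ≤ t) :
    decay y₀ a t = decay y₀ b t := by
  rw [decay, decay, intervalIntegral.integral_congr_ae]
  rw [ae_restrict_iff' measurableSet_Ioi] at hab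
  filter_upwards [hab] with s hs h
  rw [uIoc_of_le ht] at h
  exact hs h.1

lemma decay_eq_mul_exp (ha : IsTame a) {s t : ℝ} (hs : 0 ≤ s) (ht : 0 ≤ t) :
    decay y₀ a t = decay y₀ a s * Real.exp (-∫ r in s..t, a r) := by
  rw [decay, decay, mul_assoc, ← Real.exp_add, ← intervalIntegral.integral_add_adjacent_intervals
    (ha.intervalIntegrable le_rfl hs) (ha.intervalIntegrable hs ht)]
  ring_nf

lemma decay_le (ha : IsTame a) (hy : 0 ≤ y₀) (hk : ∀ t, 0 ≤ t → k ≤ a t) {s t : ℝ}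
    (hs : 0 ≤ s) (hst : s ≤ t) :
    decay y₀ a t ≤ Real.exp (-(k * (t - s))) * decay y₀ a s := by
  rw [decay_eq_mul_exp ha hs (hs.trans hst), mul_comm]
  refine mul_le_mul_of_nonneg_right (Real.exp_le_exp.2 (neg_le_neg ?_)) (decay_nonneg hy s)
  have := intervalIntegral.integral_mono_on hst (intervalIntegrable_const (c := k))
    (ha.intervalIntegrable hs (hs.trans hst)) fun r hr => hk r (hs.trans hr.1)
  simp only [intervalIntegral.integral_const, smul_eq_mul] at this
  linarith

lemma decay_eq_of_ae (ha : IsTame a) {s : ℝ} (hs : 0 ≤ s)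
    (hk : ∀ᵐ r ∂volume.restrict (Ioi s), a r = k) {t : ℝ} (hst : s ≤ t) :
    decay y₀ a t = Real.exp (-(k * (t - s))) * decay y₀ a s := by
  rw [decay_eq_mul_exp ha hs (hs.trans hst), mul_comm]
  congr 3
  rw [intervalIntegral.integral_congr_ae (g := fun _ => k)]
  · simp only [intervalIntegral.integral_const, smul_eq_mul]
    ring
  · rw [ae_restrict_iff' measurableSet_Ioi] at hk
    filter_upwards [hk] with r hr h
    rw [uIoc_of_le hst] at h
    exact hr h.1

lemma decay_antitoneOn (ha : IsTame a) (hy : 0 ≤ y₀) (ha0 : ∀ t, 0 ≤ t → 0 ≤ a t) :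
    AntitoneOn (decay y₀ a) (Ici 0) := fun s hs t _ hst => by
  simpa using decay_le ha hy ha0 hs hst

lemma decay_le_self (ha : IsTame a) (hy : 0 ≤ y₀) (ha0 : ∀ t, 0 ≤ t → 0 ≤ a t) {t : ℝ}
    (ht : 0 ≤ t) : decay y₀ a t ≤ y₀ := by
  simpa using decay_antitoneOn ha hy ha0 (mem_Ici.2 le_rfl) ht ht

lemma isTame_decay (ha : IsTame a) (hy : 0 ≤ y₀) (ha0 : ∀ t, 0 ≤ t → 0 ≤ a t) :
    IsTame (decay y₀ a) :=
  .of_continuousOn_of_bound (continuousOn_decay ha) (C := y₀) fun t ht => by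
    rw [abs_of_nonneg (decay_nonneg hy t)]
    exact decay_le_self ha hy ha0 ht

lemma decay_lt (ha : IsTame a) (hy : 0 < y₀) (hk0 : 0 < k) (hk : ∀ t, 0 ≤ t → k ≤ a t) {s t : ℝ}
    (hs : 0 ≤ s) (hst : s < t) : decay y₀ a t < decay y₀ a s := by
  refine (decay_le ha hy.le hk hs hst.le).trans_lt ?_
  have h1 : Real.exp (-(k * (t - s))) < 1 := Real.exp_lt_one_iff.2 (by nlinarith)
  have h2 : 0 < decay y₀ a s := mul_pos hy (Real.exp_pos _)
  nlinarith

/-- A continuous solution of `y' = -a y` in integrated form is `decay`. -/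
lemma eq_decay_of_integral_eq {y : ℝ → ℝ} (hy : ContinuousOn y (Ici 0)) (ha : IsTame a)
    (h : ∀ t, 0 ≤ t → y t = y₀ - ∫ s in (0 : ℝ)..t, a s * y s) {t : ℝ} (ht : 0 ≤ t) :
    y t = decay y₀ a t := by
  have hint : ∀ t, 0 ≤ t → IntervalIntegrable (fun s => a s * y s) volume 0 t := fun t ht =>
    (ha.intervalIntegrable le_rfl ht).mul_continuousOn
      (hy.mono (by rw [uIcc_of_le ht]; exact Icc_subset_Ici_self))
  have hmeas : AEStronglyMeasurable (fun s => a s * y s) (volume.restrict (Ioi 0)) :=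
    ha.aestronglyMeasurable.mul
      ((hy.mono Ioi_subset_Ici_self).aestronglyMeasurable measurableSet_Ioi)
  have hderiv : ∀ s, 0 < s → ContinuousAt a s → HasDerivAt y (-(a s * y s)) s := by
    intro s hs hc
    have hyc : ContinuousAt y s := hy.continuousAt (Ici_mem_nhds hs)
    have h1 := (intervalIntegral.integral_hasDerivAt_right (hint s hs.le)
      ⟨Ioi 0, Ioi_mem_nhds hs, hmeas⟩ (hc.mul hyc)).const_sub y₀
    refine h1.congr_of_eventuallyEq ?_
    filter_upwards [Ioi_mem_nhds hs] with r hr using h r (le_of_lt hr)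
  have h0 : y 0 = y₀ := by simpa using h 0 le_rfl
  have hcE : ContinuousOn (fun t => Real.exp (∫ s in (0 : ℝ)..t, a s)) (Ici 0) :=
    Real.continuous_exp.comp_continuousOn ha.continuousOn_primitive
  have key := integral_eq_of_hasDerivAt_off_countable_of_le
    (fun t => y t * Real.exp (∫ s in (0 : ℝ)..t, a s)) (fun _ => 0) ht ha.countable_disc
    ((hy.mul hcE).mono Icc_subset_Ici_self) (fun s hs => by
      have hc : ContinuousAt a s := by
        by_contra hc
        exact hs.2 ⟨hs.1.1, hc⟩
      exact ((hderiv s hs.1.1 hc).fun_mul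
        (ha.hasDerivAt_primitive hs.1.1 hc).exp).congr_deriv (by ring)) (by simp)
  simp only [intervalIntegral.integral_zero, intervalIntegral.integral_same, Real.exp_zero,
    mul_one, h0] at key
  rw [decay, Real.exp_neg, ← div_eq_mul_inv, eq_div_iff (Real.exp_pos _).ne']
  linarith

lemma decay_eq_sub_integral (ha : IsTame a) (hy : 0 ≤ y₀) (ha0 : ∀ t, 0 ≤ t → 0 ≤ a t) {s t : ℝ}
    (hs : 0 ≤ s) (hst : s ≤ t) :
    decay y₀ a t - decay y₀ a s = -∫ r in s..t, a r * decay y₀ a r := by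
  have := integral_eq_of_hasDerivAt_off_countable_of_le (decay y₀ a)
    (fun r => -(a r * decay y₀ a r)) hst ha.countable_disc
    ((continuousOn_decay ha).mono (Icc_subset_Ici_self.trans (Ici_subset_Ici.2 hs)))
    (fun r hr => hasDerivAt_decay ha (hs.trans_lt hr.1.1) (by
      by_contra hc
      exact hr.2 ⟨hs.trans_lt hr.1.1, hc⟩))
    (((ha.mul (isTame_decay ha hy ha0)).neg).intervalIntegrable hs (hs.trans hst))
  rw [← this, intervalIntegral.integral_neg]

end decay

/-! ### Trajectories of the game -/

namespace ContentGame

variable {N : ℕ} {G : ContentGame N} {u x : Fin N → ℝ → ℝ}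

lemma IsTrajectory.continuousOn_total (h : G.IsTrajectory u x) :
    ContinuousOn (total x) (Ici 0) :=
  continuousOn_finsetSum _ fun i _ => h.continuousOn i

lemma IsTrajectory.one_sub_total_eq_sub_integral (h : G.IsTrajectory u x)
    (hint : ∀ i, ∀ t, 0 ≤ t → IntervalIntegrable (G.rate u x i) volume 0 t) {t : ℝ}
    (ht : 0 ≤ t) :
    1 - total x t =
      (1 - ∑ i, G.z i) - ∫ s in (0 : ℝ)..t, (∑ i, G.lam i * u i s) * (1 - total x s) := by
  have h1 : total x t = ∑ i, (G.z i + ∫ s in (0 : ℝ)..t, G.rate u x i s) :=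
    Finset.sum_congr rfl fun i _ => h.eq_integral i t ht
  rw [h1, Finset.sum_add_distrib, ← intervalIntegral.integral_finsetSum fun i _ => hint i t ht]
  simp only [rate, Finset.sum_mul]
  ring

lemma IsTrajectory.one_sub_total_eq_decay (h : G.IsTrajectory u x) (hu : ∀ i, IsTame (u i))
    {t : ℝ} (ht : 0 ≤ t) :
    1 - total x t = decay (1 - ∑ i, G.z i) (fun s => ∑ i, G.lam i * u i s) t := by
  refine eq_decay_of_integral_eq (y := fun t => 1 - total x t)
    (continuousOn_const.sub h.continuousOn_total)
    (IsTame.sum _ fun i _ => (hu i).const_mul _) (fun t ht => ?_) ht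
  refine h.one_sub_total_eq_sub_integral (fun i t ht => ?_) ht
  refine (((hu i).const_mul _).intervalIntegrable le_rfl ht).mul_continuousOn ?_
  rw [uIcc_of_le ht]
  exact (continuousOn_const.sub h.continuousOn_total).mono Icc_subset_Ici_self

lemma exists_isTrajectory (hu : ∀ i, IsTame (u i)) (hz : ∑ i, G.z i ≤ 1)
    (hnn : ∀ t, 0 ≤ t → 0 ≤ ∑ i, G.lam i * u i t) : ∃ x, G.IsTrajectory u x := by
  have ha : IsTame (fun s => ∑ i, G.lam i * u i s) := IsTame.sum _ fun i _ => (hu i).const_mul _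
  have hy : 0 ≤ 1 - ∑ i, G.z i := by linarith
  set y := decay (1 - ∑ i, G.z i) (fun s => ∑ i, G.lam i * u i s) with hydef
  have hr : ∀ i, IsTame (fun s => G.lam i * u i s * y s) := fun i =>
    ((hu i).const_mul _).mul (isTame_decay ha hy hnn)
  set x : Fin N → ℝ → ℝ := fun i t => G.z i + ∫ s in (0 : ℝ)..t, G.lam i * u i s * y s with hx
  have htot : ∀ t, 0 ≤ t → 1 - total x t = y t := by
    intro t ht
    have h1 := decay_eq_sub_integral ha hy hnn le_rfl ht
    rw [decay_zero] at h1
    simp only [total, hx, Finset.sum_add_distrib]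
    rw [← intervalIntegral.integral_finsetSum
      fun i _ => (hr i).intervalIntegrable le_rfl ht]
    simp only [← Finset.sum_mul]
    linarith
  refine ⟨x, fun i => continuousOn_const.add (hr i).continuousOn_primitive, fun i t ht => ?_⟩
  simp only [hx, add_right_inj]
  refine intervalIntegral.integral_congr fun s hs => ?_
  rw [uIcc_of_le ht] at hs
  simp only [rate]
  rw [← htot s hs.1]

end ContentGame

/-! ### The marginal value of acceleration -/

/-- The discounted future `∫₀^∞ e^{-p r} y (t + r) dr` of `y`, seen from time `t`. -/
noncomputable def discountedFuture (p : ℝ) (y : ℝ → ℝ) (t : ℝ) : ℝ :=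
  ∫ r in Ioi (0 : ℝ), Real.exp (-(p * r)) * y (t + r)

/-- The marginal value of acceleration for one of `n` players who all use the same control, where
`y` is the fraction of viewers still to be reached: up to the factor `lam`, it is the rate at which
additional acceleration at time `t` increases the discounted number of viewers gained. -/
noncomputable def marginalValue (p n : ℝ) (y : ℝ → ℝ) (t : ℝ) : ℝ :=
  (n - 1) / n * y t + p / n * discountedFuture p y t

section marginalValue

variable {p n k C : ℝ} {y : ℝ → ℝ}

lemma isTame_comp_add (hyc : ContinuousOn y (Ici 0)) (hyb : ∀ t, 0 ≤ t → |y t| ≤ C) {t : ℝ}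
    (ht : 0 ≤ t) : IsTame (fun r => y (t + r)) :=
  .of_continuousOn_of_bound
    (hyc.comp (by fun_prop) fun r hr => mem_Ici.2 (add_nonneg ht (mem_Ici.1 hr)))
    (C := C) fun r hr => hyb _ (add_nonneg ht hr)

lemma discountedFuture_eq (hp : 0 < p) (hyc : ContinuousOn y (Ici 0))
    (hyb : ∀ t, 0 ≤ t → |y t| ≤ C) {t : ℝ} (ht : 0 ≤ t) :
    discountedFuture p y t = Real.exp (p * t) *
      ((∫ s in Ioi (0 : ℝ), Real.exp (-(p * s)) * y s) -
        ∫ s in (0 : ℝ)..t, Real.exp (-(p * s)) * y s) := by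
  have hint := (IsTame.of_continuousOn_of_bound hyc hyb).integrableOn_discounted hp
  have h1 : (∫ s in (0 : ℝ)..t, Real.exp (-(p * s)) * y s) +
      ∫ s in Ioi t, Real.exp (-(p * s)) * y s = ∫ s in Ioi (0 : ℝ), Real.exp (-(p * s)) * y s := by
    rw [intervalIntegral.integral_of_le ht, ← Ioc_union_Ioi_eq_Ioi ht,
      setIntegral_union (Ioc_disjoint_Ioi le_rfl) measurableSet_Ioi
        (hint.mono_set Ioc_subset_Ioi_self) (hint.mono_set (Ioi_subset_Ioi ht))]
  have h2 := (measurePreserving_add_left volume t).setIntegral_preimage_emb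
    (measurableEmbedding_addLeft t) (fun s => Real.exp (-(p * s)) * y s) (Ioi t)
  have h3 : (fun r => t + r) ⁻¹' Ioi t = Ioi 0 := by
    ext r
    simp
  rw [h3] at h2
  rw [← h1, add_sub_cancel_left, ← h2, ← integral_const_mul, discountedFuture]
  refine integral_congr_ae (ae_of_all _ fun r => ?_)
  simp only
  rw [← mul_assoc, ← Real.exp_add]
  ring_nf

lemma isTame_discounted (hp : 0 < p) (hyc : ContinuousOn y (Ici 0))
    (hyb : ∀ t, 0 ≤ t → |y t| ≤ C) : IsTame (fun s => Real.exp (-(p * s)) * y s) := by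
  refine IsTame.mul (.of_continuousOn_of_bound (by fun_prop) (C := 1) fun t ht => ?_)
    (.of_continuousOn_of_bound hyc hyb)
  rw [abs_of_pos (Real.exp_pos _), Real.exp_le_one_iff]
  nlinarith

lemma continuousOn_discountedFuture (hp : 0 < p) (hyc : ContinuousOn y (Ici 0))
    (hyb : ∀ t, 0 ≤ t → |y t| ≤ C) : ContinuousOn (discountedFuture p y) (Ici 0) := by
  have : ContinuousOn (fun t => Real.exp (p * t) *
      ((∫ s in Ioi (0 : ℝ), Real.exp (-(p * s)) * y s) -
        ∫ s in (0 : ℝ)..t, Real.exp (-(p * s)) * y s)) (Ici 0) :=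
    ContinuousOn.mul (by fun_prop)
      (continuousOn_const.sub (isTame_discounted hp hyc hyb).continuousOn_primitive)
  exact this.congr fun t ht => discountedFuture_eq hp hyc hyb ht

lemma hasDerivAt_discountedFuture (hp : 0 < p) (hyc : ContinuousOn y (Ici 0))
    (hyb : ∀ t, 0 ≤ t → |y t| ≤ C) {t : ℝ} (ht : 0 < t) :
    HasDerivAt (discountedFuture p y) (p * discountedFuture p y t - y t) t := by
  have hc : ContinuousAt (fun s => Real.exp (-(p * s)) * y s) t :=
    ContinuousAt.mul (by fun_prop) (hyc.continuousAt (Ici_mem_nhds ht))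
  have he : HasDerivAt (fun t : ℝ => Real.exp (p * t)) (Real.exp (p * t) * (p * 1)) t :=
    ((hasDerivAt_id t).const_mul p).exp
  have h1 := he.fun_mul (((isTame_discounted hp hyc hyb).hasDerivAt_primitive ht hc).const_sub
    (∫ s in Ioi (0 : ℝ), Real.exp (-(p * s)) * y s))
  have h2 := h1.congr_of_eventuallyEq (f₁ := discountedFuture p y) (by
    filter_upwards [Ioi_mem_nhds ht] with s hs using discountedFuture_eq hp hyc hyb (le_of_lt hs))
  refine h2.congr_deriv ?_
  rw [discountedFuture_eq hp hyc hyb ht.le]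
  have : Real.exp (p * t) * Real.exp (-(p * t)) = 1 := by rw [← Real.exp_add]; simp
  linear_combination (-(y t)) * this

lemma discountedFuture_mono (hp : 0 < p) {z : ℝ → ℝ} {c t s : ℝ} (ht : 0 ≤ t) (hs : 0 ≤ s)
    (hyc : ContinuousOn y (Ici 0)) (hyb : ∀ t, 0 ≤ t → |y t| ≤ C)
    (hzc : ContinuousOn z (Ici 0)) {C' : ℝ} (hzb : ∀ t, 0 ≤ t → |z t| ≤ C')
    (h : ∀ r, 0 < r → y (t + r) ≤ c * z (s + r)) :
    discountedFuture p y t ≤ c * discountedFuture p z s := by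
  rw [discountedFuture, discountedFuture, ← integral_const_mul]
  refine setIntegral_mono_on ((isTame_comp_add hyc hyb ht).integrableOn_discounted hp)
    (((isTame_comp_add hzc hzb hs).integrableOn_discounted hp).const_mul c) measurableSet_Ioi
    fun r hr => ?_
  have := mul_le_mul_of_nonneg_left (h r hr) (Real.exp_pos (-(p * r))).le
  linarith

lemma integral_exp_neg_mul_exp_neg (hpk : 0 < p + k) (c : ℝ) :
    ∫ r in Ioi (0 : ℝ), Real.exp (-(p * r)) * (Real.exp (-(k * r)) * c) = c / (p + k) := by
  have h1 := integral_exp_mul_Ioi (a := -(p + k)) (by linarith) 0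
  have h2 : ∀ r : ℝ, Real.exp (-(p * r)) * (Real.exp (-(k * r)) * c) =
      Real.exp (-(p + k) * r) * c := fun r => by
    rw [← mul_assoc, ← Real.exp_add]
    ring_nf
  simp only [h2]
  rw [integral_mul_const, h1]
  simp only [mul_zero, Real.exp_zero, neg_div_neg_eq]
  ring

/-- The factor by which the marginal value is proportional to `y` when `y` decays at rate `k`. -/
noncomputable def steadyFactor (p n k : ℝ) : ℝ := (n - 1) / n + p / n / (p + k)

lemma marginalValue_eq_of_decay {t : ℝ} (hpk : 0 < p + k)
    (h : ∀ r, 0 < r → y (t + r) = Real.exp (-(k * r)) * y t) :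
    marginalValue p n y t = steadyFactor p n k * y t := by
  have : discountedFuture p y t = y t / (p + k) := by
    rw [← integral_exp_neg_mul_exp_neg hpk, discountedFuture]
    refine setIntegral_congr_fun measurableSet_Ioi fun r hr => ?_
    rw [h r hr]
  rw [marginalValue, steadyFactor, this]
  ring

/-- On `[0, ∞)`, the function `y` is continuous, nonnegative, bounded by `C` and decays at least at
the exponential rate `k`. -/
structure DecaysAtRate (k C : ℝ) (y : ℝ → ℝ) : Prop where
  continuousOn : ContinuousOn y (Ici 0)
  abs_le : ∀ t, 0 ≤ t → |y t| ≤ C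
  nonneg : ∀ t, 0 ≤ t → 0 ≤ y t
  le_exp_mul : ∀ s t, 0 ≤ s → s ≤ t → y t ≤ Real.exp (-(k * (t - s))) * y s

lemma decaysAtRate_decay {y₀ : ℝ} {a : ℝ → ℝ} (ha : IsTame a) (hy : 0 ≤ y₀) (hk0 : 0 ≤ k)
    (hk : ∀ t, 0 ≤ t → k ≤ a t) : DecaysAtRate k y₀ (decay y₀ a) where
  continuousOn := continuousOn_decay ha
  abs_le := fun t ht => by
    rw [abs_of_nonneg (decay_nonneg hy t)]
    exact decay_le_self ha hy (fun t ht => hk0.trans (hk t ht)) ht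
  nonneg := fun t _ => decay_nonneg hy t
  le_exp_mul := fun s t hs hst => decay_le ha hy hk hs hst

namespace DecaysAtRate

lemma marginalValue_nonneg (hy : DecaysAtRate k C y) (hp : 0 < p) (hn : 1 ≤ n) {t : ℝ}
    (ht : 0 ≤ t) : 0 ≤ marginalValue p n y t := by
  have h1 : 0 ≤ discountedFuture p y t := setIntegral_nonneg measurableSet_Ioi fun r hr =>
    mul_nonneg (Real.exp_pos _).le (hy.nonneg _ (add_nonneg ht (le_of_lt hr)))
  have h2 := hy.nonneg t ht
  have h3 : 0 ≤ n - 1 := by linarith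
  rw [marginalValue]
  positivity

lemma marginalValue_le_exp_mul (hy : DecaysAtRate k C y) (hp : 0 < p) (hn : 1 ≤ n) {s t : ℝ}
    (hs : 0 ≤ s) (hst : s ≤ t) :
    marginalValue p n y t ≤ Real.exp (-(k * (t - s))) * marginalValue p n y s := by
  have h1 : discountedFuture p y t ≤ Real.exp (-(k * (t - s))) * discountedFuture p y s := by
    refine discountedFuture_mono hp (hs.trans hst) hs hy.continuousOn hy.abs_le hy.continuousOn
      hy.abs_le fun r hr => ?_
    have := hy.le_exp_mul (s + r) (t + r) (by linarith) (by linarith)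
    rwa [add_sub_add_right_eq_sub] at this
  have h2 := hy.le_exp_mul s t hs hst
  have h3 : 0 ≤ (n - 1) / n := div_nonneg (by linarith) (by linarith)
  have h4 : 0 ≤ p / n := by positivity
  rw [marginalValue, marginalValue]
  linarith [mul_le_mul_of_nonneg_left h1 h4, mul_le_mul_of_nonneg_left h2 h3]

lemma marginalValue_le (hy : DecaysAtRate k C y) (hp : 0 < p) (hk : 0 ≤ k) (hn : 1 ≤ n) {t : ℝ}
    (ht : 0 ≤ t) : marginalValue p n y t ≤ steadyFactor p n k * y t := by
  have h1 : discountedFuture p y t ≤ y t / (p + k) := by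
    rw [← integral_exp_neg_mul_exp_neg (by linarith), discountedFuture]
    refine setIntegral_mono_on
      ((isTame_comp_add hy.continuousOn hy.abs_le ht).integrableOn_discounted hp) ?_
      measurableSet_Ioi fun r hr => ?_
    · refine IsTame.integrableOn_discounted (IsTame.mul (.of_continuousOn_of_bound (by fun_prop)
        (C := 1) fun t ht => ?_) (IsTame.const _)) hp
      rw [abs_of_pos (Real.exp_pos _), Real.exp_le_one_iff]
      nlinarith
    · refine mul_le_mul_of_nonneg_left ?_ (Real.exp_pos _).le
      have := hy.le_exp_mul t (t + r) ht (by linarith [mem_Ioi.1 hr])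
      rwa [add_sub_cancel_left] at this
  have h4 : 0 ≤ p / n := by positivity
  have := mul_le_mul_of_nonneg_left h1 h4
  have h5 : p / n * (y t / (p + k)) = p / n / (p + k) * y t := by ring
  rw [marginalValue, steadyFactor, add_mul]
  linarith

lemma continuousOn_marginalValue (hy : DecaysAtRate k C y) (hp : 0 < p) :
    ContinuousOn (marginalValue p n y) (Ici 0) :=
  (continuousOn_const.mul hy.continuousOn).add
    (continuousOn_const.mul (continuousOn_discountedFuture hp hy.continuousOn hy.abs_le))

lemma isTame_marginalValue (hy : DecaysAtRate k C y) (hp : 0 < p) (hk : 0 ≤ k) (hn : 1 ≤ n) :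
    IsTame (marginalValue p n y) := by
  refine .of_continuousOn_of_bound (hy.continuousOn_marginalValue hp)
    (C := marginalValue p n y 0) fun t ht => ?_
  rw [abs_of_nonneg (hy.marginalValue_nonneg hp hn ht)]
  refine (hy.marginalValue_le_exp_mul hp hn le_rfl ht).trans ?_
  refine mul_le_of_le_one_left (hy.marginalValue_nonneg hp hn le_rfl) ?_
  rw [Real.exp_le_one_iff]
  nlinarith

/-- The marginal value crosses a positive level at most once, and from above. -/
lemma exists_switching_time (hy : DecaysAtRate k C y) (hp : 0 < p) (hk : 0 < k) (hn : 1 ≤ n)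
    {g : ℝ} (hg : 0 < g) :
    ∃ c, 0 ≤ c ∧ (∀ s, 0 ≤ s → s < c → g < marginalValue p n y s) ∧
      ∀ s, c < s → marginalValue p n y s < g := by
  have hexp : ∀ {r : ℝ}, 0 < r → Real.exp (-(k * r)) < 1 := fun {r} hr =>
    Real.exp_lt_one_iff.2 (by nlinarith)
  have hafter : ∀ c, 0 ≤ c → marginalValue p n y c ≤ g →
      ∀ s, c < s → marginalValue p n y s < g := fun c hc h s hs => by
    have h1 := hy.marginalValue_le_exp_mul hp hn hc hs.le
    have h2 := hexp (sub_pos.2 hs)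
    nlinarith [mul_le_mul_of_nonneg_left h (Real.exp_pos (-(k * (s - c)))).le]
  by_cases h0 : marginalValue p n y 0 ≤ g
  · exact ⟨0, le_rfl, fun s h1 h2 => absurd h1 (not_le.2 h2), hafter 0 le_rfl h0⟩
  push Not at h0
  -- the marginal value tends to zero, so it is below `g` at some time `T`
  obtain ⟨T, hT0, hT⟩ : ∃ T, 0 ≤ T ∧ marginalValue p n y T ≤ g := by
    have h1 : Tendsto (fun t => Real.exp (-(k * t)) * marginalValue p n y 0) atTop (𝓝 0) :=
      (IsTame.const (marginalValue p n y 0)).tendsto_discounted hk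
    obtain ⟨T, h2, h3⟩ := ((h1.eventually (gt_mem_nhds hg)).and (eventually_ge_atTop 0)).exists
    refine ⟨T, h3, ?_⟩
    have := hy.marginalValue_le_exp_mul hp hn le_rfl h3
    rw [sub_zero] at this
    exact this.trans h2.le
  obtain ⟨c, hc, hcg⟩ := intermediate_value_Icc' hT0
    ((hy.continuousOn_marginalValue (n := n) hp).mono Icc_subset_Ici_self) ⟨hT, h0.le⟩
  refine ⟨c, hc.1, fun s hs hsc => ?_, hafter c hc.1 hcg.le⟩
  have h1 := hy.marginalValue_le_exp_mul hp hn hs hsc.le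
  have h2 := hexp (sub_pos.2 hsc)
  rw [hcg] at h1
  have h3 := Real.exp_pos (-(k * (c - s)))
  have h4 := hy.marginalValue_nonneg hp hn hs
  by_contra! hcon
  nlinarith [mul_le_mul_of_nonneg_left hcon h3.le]

lemma hasDerivAt_marginalValue (hy : DecaysAtRate k C y) (hp : 0 < p) (hn : n ≠ 0) {b t : ℝ}
    (ht : 0 < t) (hd : HasDerivAt y (-(n * b * y t)) t) :
    HasDerivAt (marginalValue p n y) (p * marginalValue p n y t - (p + (n - 1) * b) * y t) t := by
  have := (hd.const_mul ((n - 1) / n)).add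
    ((hasDerivAt_discountedFuture hp hy.continuousOn hy.abs_le ht).const_mul (p / n))
  refine this.congr_deriv ?_
  rw [marginalValue]
  field_simp
  ring

end DecaysAtRate

end marginalValue

/-! ### Unilateral deviations from a symmetric profile -/

/-- The discounted cost of a player with control `v` when `y` is the fraction of viewers still to be
reached. -/
noncomputable def playerCost (p lam gam umin : ℝ) (v y : ℝ → ℝ) : ℝ :=
  ∫ s in Ioi (0 : ℝ), Real.exp (-(p * s)) * (-(lam * v s * y s) + gam * (v s - umin))

/-- The fraction of viewers still to be reached when one player uses `v` and each of the other
`n - 1` players uses `u`. -/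
noncomputable def deviationState (n lam y₀ : ℝ) (u v : ℝ → ℝ) : ℝ → ℝ :=
  decay y₀ fun s => lam * v s + (n - 1) * (lam * u s)

/-- Tame controls with values in `[umin, umax]`. -/
structure IsTameControl (umin umax : ℝ) (u : ℝ → ℝ) : Prop where
  isTame : IsTame u
  mem : ∀ t, 0 ≤ t → u t ∈ Icc umin umax

section deviation

variable {p n lam gam umin umax y₀ : ℝ} {u v b : ℝ → ℝ}

lemma isTame_deviationRate (hu : IsTame u) (hv : IsTame v) :
    IsTame fun s => lam * v s + (n - 1) * (lam * u s) :=
  (hv.const_mul lam).add ((hu.const_mul lam).const_mul (n - 1))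

lemma le_deviationRate (hn : 1 ≤ n) (hlam : 0 ≤ lam) (hu : IsTameControl umin umax u)
    (hv : IsTameControl umin umax v) {t : ℝ} (ht : 0 ≤ t) :
    n * lam * umin ≤ lam * v t + (n - 1) * (lam * u t) := by
  have h1 := mul_le_mul_of_nonneg_left (hu.mem t ht).1 (mul_nonneg (sub_nonneg.2 hn) hlam)
  have h2 := mul_le_mul_of_nonneg_left (hv.mem t ht).1 hlam
  linarith

lemma decaysAtRate_deviationState (hn : 1 ≤ n) (hlam : 0 ≤ lam) (humin : 0 ≤ umin) (hy : 0 ≤ y₀)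
    (hu : IsTameControl umin umax u) (hv : IsTameControl umin umax v) :
    DecaysAtRate (n * lam * umin) y₀ (deviationState n lam y₀ u v) :=
  decaysAtRate_decay (isTame_deviationRate hu.isTame hv.isTame) hy (by positivity)
    fun _ ht => le_deviationRate hn hlam hu hv ht

lemma hasDerivAt_deviationState (hu : IsTame u) (hv : IsTame v) {t : ℝ} (ht : 0 < t)
    (huc : ContinuousAt u t) (hvc : ContinuousAt v t) :
    HasDerivAt (deviationState n lam y₀ u v)
      (-((lam * v t + (n - 1) * (lam * u t)) * deviationState n lam y₀ u v t)) t :=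
  hasDerivAt_decay (isTame_deviationRate hu hv) ht (by fun_prop)

lemma deviationState_eq_mul_exp (hu : IsTame u) (hv : IsTame v) {t : ℝ} (ht : 0 ≤ t) :
    deviationState n lam y₀ u v t = deviationState n lam y₀ u u t *
      Real.exp (-∫ s in (0 : ℝ)..t, lam * (v s - u s)) := by
  rw [deviationState, deviationState, decay, decay, mul_assoc, ← Real.exp_add, ← neg_add,
    ← intervalIntegral.integral_add ((isTame_deviationRate hu hu).intervalIntegrable le_rfl ht)
      (((hv.sub hu).const_mul lam).intervalIntegrable le_rfl ht)]
  congr 3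
  refine intervalIntegral.integral_congr fun s _ => ?_
  ring

lemma isTame_costRate (hv : IsTame v) {y : ℝ → ℝ} (hy : IsTame y) :
    IsTame fun s => -(lam * v s * y s) + gam * (v s - umin) :=
  ((hv.const_mul lam).mul hy).neg.add ((hv.sub (IsTame.const _)).const_mul gam)

lemma DecaysAtRate.isTame {k C : ℝ} {y : ℝ → ℝ} (hy : DecaysAtRate k C y) : IsTame y :=
  .of_continuousOn_of_bound hy.continuousOn hy.abs_le

/-- The exact change of the cost under a deviation `v` from the symmetric profile `u`: a part linear
in `v - u`, governed by the marginal value, plus a nonnegative remainder. Both together differ from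
the cost difference by the discounted total derivative of `(y' - y) + Φ D`, where `y` and `y'` are
the states before and after the deviation, `Φ` is the marginal value and `D = ∫ lam (v - u)`. -/
lemma playerCost_sub_playerCost (hp : 0 < p) (hn : 1 ≤ n) (hlam : 0 ≤ lam) (humin : 0 ≤ umin)
    (hy : 0 ≤ y₀) (hu : IsTameControl umin umax u) (hv : IsTameControl umin umax v) :
    playerCost p lam gam umin v (deviationState n lam y₀ u v) -
        playerCost p lam gam umin u (deviationState n lam y₀ u u) =
      (∫ s in Ioi (0 : ℝ), Real.exp (-(p * s)) *
        ((gam - lam * marginalValue p n (deviationState n lam y₀ u u) s) * (v s - u s))) +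
      ∫ s in Ioi (0 : ℝ), Real.exp (-(p * s)) *
        (deviationState n lam y₀ u u s * (p + (n - 1) * (lam * u s)) *
          (Real.exp (-∫ r in (0 : ℝ)..s, lam * (v r - u r)) - 1 +
            ∫ r in (0 : ℝ)..s, lam * (v r - u r))) := by
  have hY := decaysAtRate_deviationState hn hlam humin hy hu hu
  have hY' := decaysAtRate_deviationState hn hlam humin hy hu hv
  have hk : 0 ≤ n * lam * umin := by positivity
  set y := deviationState n lam y₀ u u with hydef
  set y' := deviationState n lam y₀ u v with hydef'
  set Φ := marginalValue p n y with hΦ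
  set D : ℝ → ℝ := fun t => ∫ r in (0 : ℝ)..t, lam * (v r - u r) with hD
  have hut := hu.isTame
  have hvt := hv.isTame
  have hd := (hvt.sub hut).const_mul lam
  have hDt : IsTame D := hd.primitive
  have hyt := hY.isTame
  have hyt' := hY'.isTame
  have hΦt : IsTame Φ := hY.isTame_marginalValue hp hk hn
  have hexp : ∀ t, 0 ≤ t → y' t = y t * Real.exp (-D t) := fun t ht =>
    deviationState_eq_mul_exp hut hvt ht
  have hR : IsTame fun s => y s * (p + (n - 1) * (lam * u s)) * (Real.exp (-D s) - 1 + D s) := by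
    have h1 : IsTame fun s => (p + (n - 1) * (lam * u s)) * (y' s - y s + y s * D s) :=
      ((IsTame.const p).add ((hut.const_mul lam).const_mul _)).mul
        ((hyt'.sub hyt).add (hyt.mul hDt))
    refine h1.congr fun t ht => ?_
    rw [hexp t ht]
    ring
  have hL : IsTame fun s => (gam - lam * Φ s) * (v s - u s) :=
    ((IsTame.const gam).sub (hΦt.const_mul lam)).mul (hvt.sub hut)
  -- the boundary term and its derivative
  have hFt : IsTame fun t => (y' t - y t) + Φ t * D t := (hyt'.sub hyt).add (hΦt.mul hDt)
  have hFc : ContinuousOn (fun t => (y' t - y t) + Φ t * D t) (Ici 0) :=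
    (hY'.continuousOn.sub hY.continuousOn).add
      ((hY.continuousOn_marginalValue hp).mul hd.continuousOn_primitive)
  set f : ℝ → ℝ := fun t => (-((lam * v t + (n - 1) * (lam * u t)) * y' t) -
      -((lam * u t + (n - 1) * (lam * u t)) * y t)) +
      ((p * Φ t - (p + (n - 1) * (lam * u t)) * y t) * D t + Φ t * (lam * (v t - u t))) with hf
  have hft : IsTame f :=
    (((isTame_deviationRate hut hvt).mul hyt').neg.sub
      ((isTame_deviationRate hut hut).mul hyt).neg).add
      ((((hΦt.const_mul p).sub (((IsTame.const p).add
        ((hut.const_mul lam).const_mul _)).mul hyt)).mul hDt).add (hΦt.mul hd))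
  have hderiv : ∀ t, 0 < t →
      t ∉ {t | 0 < t ∧ ¬ContinuousAt u t} ∪ {t | 0 < t ∧ ¬ContinuousAt v t} →
      HasDerivAt (fun t => (y' t - y t) + Φ t * D t) (f t) t := by
    intro t ht hts
    simp only [mem_union, mem_ofPred_eq, not_or, not_and, not_not] at hts
    have huc := hts.1 ht
    have hvc := hts.2 ht
    have h1 := hasDerivAt_deviationState (n := n) (lam := lam) (y₀ := y₀) hut hvt ht huc hvc
    have h2 := hasDerivAt_deviationState (n := n) (lam := lam) (y₀ := y₀) hut hut ht huc huc
    have h3 : HasDerivAt Φ (p * Φ t - (p + (n - 1) * (lam * u t)) * y t) t :=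
      hY.hasDerivAt_marginalValue hp (by linarith) ht (h2.congr_deriv (by ring))
    have h4 : HasDerivAt D (lam * (v t - u t)) t := hd.hasDerivAt_primitive ht (by fun_prop)
    exact (h1.fun_sub h2).fun_add (h3.fun_mul h4)
  have hboundary := IsTame.integral_discounted_deriv hp hFt hFc hft
    (hut.countable_disc.union hvt.countable_disc) hderiv
  have hF0 : (y' 0 - y 0) + Φ 0 * D 0 = 0 := by
    simp [hydef, hydef', deviationState, hD]
  rw [hF0, neg_zero] at hboundary
  have i1 := (isTame_costRate (lam := lam) (gam := gam) (umin := umin) hvt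
    hyt').integrableOn_discounted hp
  have i2 := (isTame_costRate (lam := lam) (gam := gam) (umin := umin) hut
    hyt).integrableOn_discounted hp
  have i3 := hL.integrableOn_discounted hp
  have i4 := hR.integrableOn_discounted hp
  rw [← sub_eq_zero, playerCost, playerCost, ← integral_sub i1 i2, ← integral_add i3 i4,
    ← integral_sub (i1.fun_sub i2) (i3.fun_add i4)]
  refine (setIntegral_congr_fun measurableSet_Ioi fun t (ht : 0 < t) => ?_).trans hboundary
  simp only [hf, hexp t ht.le]
  ring

/-- The first-order condition suffices: the cost is convex in the cumulated acceleration, so the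
remainder is nonnegative. -/
lemma playerCost_le_of_first_order (hp : 0 < p) (hn : 1 ≤ n) (hlam : 0 ≤ lam) (humin : 0 ≤ umin)
    (hy : 0 ≤ y₀) (hu : IsTameControl umin umax u) (hv : IsTameControl umin umax v)
    (h : ∀ᵐ s ∂volume.restrict (Ioi 0),
      0 ≤ (gam - lam * marginalValue p n (deviationState n lam y₀ u u) s) * (v s - u s)) :
    playerCost p lam gam umin u (deviationState n lam y₀ u u) ≤
      playerCost p lam gam umin v (deviationState n lam y₀ u v) := by
  rw [← sub_nonneg, playerCost_sub_playerCost hp hn hlam humin hy hu hv]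
  refine add_nonneg (integral_nonneg_of_ae ?_) (setIntegral_nonneg measurableSet_Ioi fun s hs => ?_)
  · filter_upwards [h] with s hs using mul_nonneg (Real.exp_pos _).le hs
  · have h1 : 0 ≤ u s := humin.trans (hu.mem s (le_of_lt hs)).1
    have h2 : 0 ≤ n - 1 := by linarith
    have h3 : 0 ≤ deviationState n lam y₀ u u s := decay_nonneg hy s
    have h4 := Real.add_one_le_exp (-∫ r in (0 : ℝ)..s, lam * (v r - u r))
    refine mul_nonneg (Real.exp_pos _).le (mul_nonneg (by positivity) (by linarith))

lemma exp_neg_sub_one_add_le (x : ℝ) :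
    Real.exp (-x) - 1 + x ≤ x ^ 2 * (1 + Real.exp (-x)) := by
  have hpos := Real.exp_pos (-x)
  have h1 := Real.add_one_le_exp x
  have h2 := Real.add_one_le_exp (-x)
  have h3 : Real.exp (-x) * Real.exp x = 1 := by rw [← Real.exp_add]; simp
  have h4 : Real.exp (-x) * (x + 1) ≤ 1 := by
    nlinarith [mul_le_mul_of_nonneg_left h1 hpos.le]
  -- `exp (-x) - 1 + x ≤ x (1 - exp (-x))`, and `1 - exp (-x)` lies between `x exp (-x)` and `x`
  rcases le_total 0 x with hx | hx
  · nlinarith [mul_le_mul_of_nonneg_left h2 hx, mul_nonneg (sq_nonneg x) hpos.le]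
  · nlinarith [mul_le_mul_of_nonpos_left h4 hx, sq_nonneg x]

lemma IsTameControl.mix (hu : IsTameControl umin umax u) (hb : IsTameControl umin umax b) {ε : ℝ}
    (h0 : 0 ≤ ε) (h1 : ε ≤ 1) : IsTameControl umin umax fun s => u s + ε * (b s - u s) := by
  refine ⟨hu.isTame.add ((hb.isTame.sub hu.isTame).const_mul ε), fun t ht => ?_⟩
  obtain ⟨h2, h3⟩ := hu.mem t ht
  obtain ⟨h4, h5⟩ := hb.mem t ht
  constructor <;> nlinarith

/-- The first-order condition is necessary: along the segment from `u` to `b` the remainder is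
quadratic. -/
lemma first_order_of_playerCost_le (hp : 0 < p) (hn : 1 ≤ n) (hlam : 0 ≤ lam) (humin : 0 ≤ umin)
    (hy : 0 ≤ y₀) (hu : IsTameControl umin umax u) (hb : IsTameControl umin umax b)
    (h : ∀ ε, 0 < ε → ε ≤ 1 → playerCost p lam gam umin u (deviationState n lam y₀ u u) ≤
      playerCost p lam gam umin (fun s => u s + ε * (b s - u s))
        (deviationState n lam y₀ u fun s => u s + ε * (b s - u s))) :
    0 ≤ ∫ s in Ioi (0 : ℝ), Real.exp (-(p * s)) *
      ((gam - lam * marginalValue p n (deviationState n lam y₀ u u) s) * (b s - u s)) := by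
  set L := ∫ s in Ioi (0 : ℝ), Real.exp (-(p * s)) *
      ((gam - lam * marginalValue p n (deviationState n lam y₀ u u) s) * (b s - u s)) with hL
  set y := deviationState n lam y₀ u u with hydef
  set D : ℝ → ℝ := fun t => ∫ r in (0 : ℝ)..t, lam * (b r - u r) with hD
  have hY : DecaysAtRate (n * lam * umin) y₀ y :=
    decaysAtRate_deviationState hn hlam humin hy hu hu
  have hDt : IsTame D := ((hb.isTame.sub hu.isTame).const_mul lam).primitive
  have hbd : IsTame fun s => (p + (n - 1) * (lam * u s)) * (D s * D s * (2 * y₀)) :=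
    ((IsTame.const p).add ((hu.isTame.const_mul lam).const_mul _)).mul
      ((hDt.mul hDt).mul (IsTame.const _))
  set C := ∫ s in Ioi (0 : ℝ), Real.exp (-(p * s)) *
      ((p + (n - 1) * (lam * u s)) * (D s * D s * (2 * y₀))) with hC
  have key : ∀ ε, 0 < ε → ε ≤ 1 → 0 ≤ L + ε * C := by
    intro ε h0 h1
    have hv := hu.mix hb h0.le h1
    have hle := h ε h0 h1
    rw [← sub_nonneg, playerCost_sub_playerCost hp hn hlam humin hy hu hv] at hle
    have e1 : ∀ t, ∫ r in (0 : ℝ)..t, lam * (u r + ε * (b r - u r) - u r) = ε * D t := by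
      intro t
      rw [hD, ← intervalIntegral.integral_const_mul]
      refine intervalIntegral.integral_congr fun s _ => ?_
      ring
    have e2 : (∫ s in Ioi (0 : ℝ), Real.exp (-(p * s)) *
        ((gam - lam * marginalValue p n y s) * (u s + ε * (b s - u s) - u s))) = ε * L := by
      rw [hL, ← integral_const_mul]
      refine setIntegral_congr_fun measurableSet_Ioi fun s _ => ?_
      ring
    have hyv : ∀ t, 0 ≤ t → y t * Real.exp (-(ε * D t)) ≤ y₀ := by
      intro t ht
      rw [← e1 t, hydef, ← deviationState_eq_mul_exp hu.isTame hv.isTame ht]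
      exact (le_abs_self _).trans
        ((decaysAtRate_deviationState hn hlam humin hy hu hv).abs_le t ht)
    have e3 : (∫ s in Ioi (0 : ℝ), Real.exp (-(p * s)) *
        (y s * (p + (n - 1) * (lam * u s)) * (Real.exp (-(ε * D s)) - 1 + ε * D s))) ≤
        ε ^ 2 * C := by
      rw [hC, ← integral_const_mul]
      refine integral_mono_of_nonneg ?_ ((hbd.integrableOn_discounted hp).const_mul _) ?_
      · filter_upwards [ae_restrict_mem measurableSet_Ioi] with s hs
        have h1 : 0 ≤ u s := humin.trans (hu.mem s (le_of_lt hs)).1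
        have h2 : 0 ≤ n - 1 := by linarith
        have h3 : 0 ≤ y s := hY.nonneg s (le_of_lt hs)
        have h4 := Real.add_one_le_exp (-(ε * D s))
        exact mul_nonneg (Real.exp_pos _).le (mul_nonneg (by positivity) (by linarith))
      · filter_upwards [ae_restrict_mem measurableSet_Ioi] with s hs
        have h1 : 0 ≤ u s := humin.trans (hu.mem s (le_of_lt hs)).1
        have h2 : 0 ≤ n - 1 := by linarith
        have h3 : 0 ≤ y s := hY.nonneg s (le_of_lt hs)
        have h4 : y s ≤ y₀ := (le_abs_self _).trans (hY.abs_le s (le_of_lt hs))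
        have h5 := hyv s (le_of_lt hs)
        have h6 := mul_le_mul_of_nonneg_left (exp_neg_sub_one_add_le (ε * D s)) h3
        have h7 : y s * ((ε * D s) ^ 2 * (1 + Real.exp (-(ε * D s)))) ≤
            (ε * D s) ^ 2 * (2 * y₀) := by
          have := mul_le_mul_of_nonneg_left (add_le_add h4 h5) (sq_nonneg (ε * D s))
          linarith
        have h8 : 0 ≤ p + (n - 1) * (lam * u s) := by positivity
        have h9 := mul_le_mul_of_nonneg_left (mul_le_mul_of_nonneg_left (h6.trans h7) h8)
          (Real.exp_pos (-(p * s))).le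
        linarith
    simp only [← hydef, e1] at hle
    rw [e2] at hle
    have : 0 ≤ ε * (L + ε * C) := by linarith
    exact nonneg_of_mul_nonneg_right this h0
  have hlim : Tendsto (fun ε => L + ε * C) (𝓝[>] 0) (𝓝 (L + 0 * C)) :=
    (Continuous.tendsto (by fun_prop) 0).mono_left nhdsWithin_le_nhds
  rw [zero_mul, add_zero] at hlim
  refine ge_of_tendsto hlim ?_
  filter_upwards [Ioc_mem_nhdsGT (zero_lt_one' ℝ)] with ε hε using key ε hε.1 hε.2

end deviation

/-! ### The value function against threshold feedback -/

/-- The optimal payoff of a player whose opponents follow the threshold law, as a function of the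
fraction `y` of viewers still to be reached, where `ys` is the level of `y` at the threshold. It is
linear with slope `c` below `ys`; above `ys`, for the coefficients in `IsValueCoeff`, it solves a
linear differential equation of first order, whence the power. The slope jumps at `ys` as soon as
there are opponents. -/
noncomputable def thresholdValue (ys c al m K y : ℝ) : ℝ :=
  c * min y ys + al * (max y ys - ys) + K * ((max (y / ys) 1) ^ (-m) - 1)

/-- The product `y P'(y)` for the value function `P = thresholdValue ys c al m K`. -/
noncomputable def thresholdValueSlope (ys c al m K y : ℝ) : ℝ :=
  if y < ys then c * y else al * y - K * m * (max (y / ys) 1) ^ (-m)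

/-- The relations that determine the coefficients of the value function: `c` and `al` are the
discounted gains of a player per viewer still to be reached if all `n` players use `umin` or `umax`
forever, `m` is the exponent of the homogeneous solution of the equation above `ys`, `K` matches the
two pieces at `ys`, and at `ys` a player is indifferent between all controls. -/
structure IsValueCoeff (p n lam gam umin umax ys c al m K : ℝ) : Prop where
  low : c * (p + n * lam * umin) = lam * umin
  high : al * (p + n * lam * umax) = lam * umax
  exponent : m * (n * lam * umax) = p
  continuity : p * K = gam * (umax - umin) - p * (al - c) * ys
  indifference : lam * ys * (1 - c) = gam

section thresholdValue

variable {p n lam gam umin umax ys c al m K : ℝ}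

lemma continuous_thresholdValue : Continuous (thresholdValue ys c al m K) := by
  have h : Continuous fun y : ℝ => (max (y / ys) 1) ^ (-m) :=
    (by fun_prop : Continuous fun y : ℝ => max (y / ys) 1).rpow_const fun y =>
      Or.inl (ne_of_gt (zero_lt_one.trans_le (le_max_right _ _)))
  unfold thresholdValue
  fun_prop

lemma thresholdValue_of_le (hys : 0 < ys) {y : ℝ} (h : y ≤ ys) :
    thresholdValue ys c al m K y = c * y := by
  have h1 : y / ys ≤ 1 := (div_le_one hys).2 h
  simp [thresholdValue, h, h1]

lemma thresholdValue_of_ge (hys : 0 < ys) {y : ℝ} (h : ys ≤ y) :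
    thresholdValue ys c al m K y = c * ys + al * (y - ys) + K * ((y / ys) ^ (-m) - 1) := by
  have h1 : 1 ≤ y / ys := (one_le_div hys).2 h
  simp [thresholdValue, h, h1]

lemma max_div_rpow_le_one (hm : 0 ≤ m) (y : ℝ) : (max (y / ys) 1) ^ (-m) ≤ 1 :=
  Real.rpow_le_one_of_one_le_of_nonpos (le_max_right _ _) (by linarith)

lemma hasDerivAt_thresholdValue_comp (hys : 0 < ys) {y : ℝ → ℝ} {a t : ℝ}
    (hd : HasDerivAt y (-(a * y t)) t) (hne : y t ≠ ys) :
    HasDerivAt (fun s => thresholdValue ys c al m K (y s))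
      (-(a * thresholdValueSlope ys c al m K (y t))) t := by
  rcases lt_or_gt_of_ne hne with h | h
  · rw [thresholdValueSlope, if_pos h]
    refine ((hd.const_mul c).congr_of_eventuallyEq ?_).congr_deriv (by ring)
    filter_upwards [hd.continuousAt.eventually (gt_mem_nhds h)] with s hs
    exact thresholdValue_of_le hys hs.le
  · have h1 : 1 < y t / ys := (one_lt_div hys).2 h
    have h0 : y t / ys ≠ 0 := by linarith
    rw [thresholdValueSlope, if_neg (not_lt.2 h.le), max_eq_left h1.le]
    have h2 := (hd.div_const ys).rpow_const (p := -m) (Or.inl h0)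
    have h3 := (((hd.sub_const ys).const_mul al).const_add (c * ys)).add
      ((h2.sub_const 1).const_mul K)
    refine (h3.congr_of_eventuallyEq ?_).congr_deriv ?_
    · filter_upwards [hd.continuousAt.eventually (lt_mem_nhds h)] with s hs
      exact thresholdValue_of_ge hys hs.le
    · have h4 : (y t / ys) ^ (-m - 1) * (y t / ys) = (y t / ys) ^ (-m) := by
        rw [Real.rpow_sub_one h0, div_mul_cancel₀ _ h0]
      linear_combination (a * K * m) * h4

/-- The Hamilton–Jacobi–Bellman inequality for the value function, with equality if the player uses
the control `q` of the opponents. -/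
lemma hamiltonJacobiBellman (hp : 0 < p) (hn : 1 ≤ n) (hlam : 0 < lam) (humin : 0 < umin)
    (hu : umin < umax) (hys : 0 < ys) (h : IsValueCoeff p n lam gam umin umax ys c al m K)
    {v q y : ℝ} (hv : v ∈ Icc umin umax) (hne : y ≠ ys) (hlow : y < ys → q = umin)
    (hhigh : ys < y → q = umax) :
    lam * v * y - gam * (v - umin) ≤ p * thresholdValue ys c al m K y +
        (lam * v + (n - 1) * (lam * q)) * thresholdValueSlope ys c al m K y ∧
      (v = q → lam * v * y - gam * (v - umin) = p * thresholdValue ys c al m K y +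
        (lam * v + (n - 1) * (lam * q)) * thresholdValueSlope ys c al m K y) := by
  obtain ⟨hc, hal, hm, hK, hg⟩ := h
  have hn0 : 0 < n := by linarith
  have humax : 0 < umax := humin.trans hu
  have hc0 : 0 < c := by
    have : 0 < p + n * lam * umin := by positivity
    exact (pos_iff_pos_of_mul_pos (hc ▸ mul_pos hlam humin)).2 this
  have hc1 : c < 1 := by
    by_contra! hcon
    have : lam * umin ≤ n * lam * umin := by nlinarith [mul_pos hlam humin]
    nlinarith [mul_pos hlam humin]
  rcases lt_or_gt_of_ne hne with hy | hy
  · -- below the threshold level, acceleration does not pay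
    rw [thresholdValue_of_le hys hy.le, thresholdValueSlope, if_pos hy, hlow hy]
    have e : p * (c * y) + (lam * v + (n - 1) * (lam * umin)) * (c * y) -
        (lam * v * y - gam * (v - umin)) = (v - umin) * (lam * (ys - y) * (1 - c)) := by
      linear_combination y * hc - (v - umin) * hg
    refine ⟨?_, fun hvq => ?_⟩
    · have : 0 ≤ (v - umin) * (lam * (ys - y) * (1 - c)) := by
        have := hv.1
        have h1 : 0 ≤ v - umin := by linarith
        have h2 : 0 ≤ ys - y := by linarith
        have h3 : 0 ≤ 1 - c := by linarith
        positivity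
      linarith
    · rw [hvq, sub_self, zero_mul] at e
      rw [hvq]
      linarith
  · -- above the threshold level it pays
    have hr1 : 1 < y / ys := (one_lt_div hys).2 hy
    have hry : y / ys * ys = y := div_mul_cancel₀ _ hys.ne'
    rw [thresholdValue_of_ge hys hy.le, thresholdValueSlope, if_neg (not_lt.2 hy.le),
      max_eq_left hr1.le, hhigh hy]
    have hm0 : 0 < m := (pos_iff_pos_of_mul_pos (hm ▸ hp)).2 (by positivity)
    have hw1 : (y / ys) ^ (-m) ≤ 1 :=
      Real.rpow_le_one_of_one_le_of_nonpos hr1.le (by linarith)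
    have hw2 : 1 - m * (y / ys - 1) ≤ (y / ys) ^ (-m) := by
      rw [Real.rpow_def_of_pos (by linarith)]
      have h1 := Real.add_one_le_exp (Real.log (y / ys) * -m)
      have h2 := Real.log_le_sub_one_of_pos (show 0 < y / ys by linarith)
      nlinarith
    set r := y / ys with hr
    set w := r ^ (-m) with hw
    -- the gain from acceleration is at least its cost at `ys`, and it increases in `y`
    have hX : lam * n * umax * (m * K - (al - c) * ys) =
        lam * c * (n - 1) * (umax - umin) * ys := by
      linear_combination K * hm + hK - (umax - umin) * hg - ys * hal + ys * hc
    have hB : (al - c) * ys ≤ m * K := by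
      have h1 : 0 ≤ lam * c * (n - 1) * (umax - umin) * ys := by
        have h2 : 0 ≤ n - 1 := by linarith
        have h3 : 0 ≤ umax - umin := by linarith
        positivity
      rw [← hX] at h1
      have := nonneg_of_mul_nonneg_right h1 (by positivity)
      linarith
    have hB2 : m * K ≤ al * ys := by
      have h1 : lam * n * umax * (al * ys - m * K) =
          lam * ys * c * (umax + (n - 1) * umin) := by linear_combination -hX
      have h2 : 0 ≤ lam * ys * c * (umax + (n - 1) * umin) := by
        have h2 : 0 ≤ n - 1 := by linarith
        positivity
      rw [← h1] at h2
      have := nonneg_of_mul_nonneg_right h2 (by positivity)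
      linarith
    have hal1 : m * al + al ≤ 1 := by
      have h1 : lam * umax * (n * (m * al + al)) = lam * umax * 1 := by
        linear_combination al * hm + hal
      have h2 := mul_left_cancel₀ (by positivity) h1
      by_contra! hcon
      nlinarith
    have hgain : (1 - c) * ys ≤ (1 - al) * y + m * K * w := by
      have h1 : (1 - al) * y = (1 - al) * ys + (1 - al) * ys * (r - 1) := by
        rw [← hry]
        ring
      have hr0 : 0 ≤ r - 1 := by linarith
      have hal0 : 0 ≤ al := by
        have : 0 < p + n * lam * umax := by positivity
        exact ((pos_iff_pos_of_mul_pos (hal ▸ mul_pos hlam humax)).2 this).le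
      rcases le_total 0 (m * K) with h0 | h0
      · have h2 := mul_le_mul_of_nonneg_left hw2 h0
        have h3 : m * (m * K) ≤ (1 - al) * ys := by
          have := mul_le_mul_of_nonneg_left hB2 hm0.le
          nlinarith
        nlinarith [mul_le_mul_of_nonneg_right h3 hr0]
      · have h2 := mul_le_mul_of_nonpos_left hw1 h0
        have h3 : 0 ≤ (1 - al) * ys := by
          have : 0 ≤ 1 - al := by nlinarith [mul_nonneg hm0.le hal0]
          positivity
        nlinarith [mul_nonneg h3 hr0]
    have e : p * (c * ys + al * (y - ys) + K * (w - 1)) +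
        (lam * v + (n - 1) * (lam * umax)) * (al * y - K * m * w) -
        (lam * v * y - gam * (v - umin)) =
        (umax - v) * (lam * ((1 - al) * y + m * K * w - (1 - c) * ys)) := by
      linear_combination y * hal - K * w * hm - hK + (umax - v) * hg
    refine ⟨?_, fun hvq => ?_⟩
    · have : 0 ≤ (umax - v) * (lam * ((1 - al) * y + m * K * w - (1 - c) * ys)) :=
        mul_nonneg (by linarith [hv.2]) (mul_nonneg hlam.le (by linarith))
      linarith
    · rw [hvq, sub_self, zero_mul] at e
      rw [hvq]
      linarith

/-- Verification: when the opponents use `umin` below and `umax` above the level `ys`, no control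
costs less than minus the value function, and using the same control as the opponents costs exactly
that. -/
lemma verification (hp : 0 < p) (hn : 1 ≤ n) (hlam : 0 < lam) (humin : 0 < umin)
    (hu : umin < umax) (hys : 0 < ys) (h : IsValueCoeff p n lam gam umin umax ys c al m K)
    {v q : ℝ → ℝ} {y₀ : ℝ} (hy : 0 ≤ y₀) (hv : IsTameControl umin umax v)
    (hq : IsTameControl umin umax q)
    (hcross : {t | 0 < t ∧ deviationState n lam y₀ q v t = ys}.Countable)
    (hlow : ∀ t, 0 ≤ t → deviationState n lam y₀ q v t < ys → q t = umin)
    (hhigh : ∀ t, 0 ≤ t → ys < deviationState n lam y₀ q v t → q t = umax) :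
    -thresholdValue ys c al m K y₀ ≤
        playerCost p lam gam umin v (deviationState n lam y₀ q v) ∧
      ((∀ t, 0 ≤ t → v t = q t) → playerCost p lam gam umin v (deviationState n lam y₀ q v) =
        -thresholdValue ys c al m K y₀) := by
  have hY := decaysAtRate_deviationState hn hlam.le humin.le hy hq hv
  have hm0 : 0 ≤ m := ((pos_iff_pos_of_mul_pos (h.exponent ▸ hp)).2
    (mul_pos (mul_pos (by linarith) hlam) (humin.trans hu))).le
  have hd0 : ∀ t, 0 < t → ContinuousAt q t → ContinuousAt v t → _ := fun t ht hqc hvc =>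
    hasDerivAt_deviationState (n := n) (lam := lam) (y₀ := y₀) hq.isTame hv.isTame ht hqc hvc
  have hy0 : deviationState n lam y₀ q v 0 = y₀ := decay_zero
  set y := deviationState n lam y₀ q v with hydef
  set a : ℝ → ℝ := fun t => lam * v t + (n - 1) * (lam * q t) with ha
  have hat : IsTame a := isTame_deviationRate hq.isTame hv.isTame
  have hPc : ContinuousOn (fun t => thresholdValue ys c al m K (y t)) (Ici 0) :=
    continuous_thresholdValue.comp_continuousOn hY.continuousOn
  have hPt : IsTame fun t => thresholdValue ys c al m K (y t) := by
    obtain ⟨C, hC⟩ := (isCompact_Icc (a := (0 : ℝ)) (b := y₀)).exists_bound_of_continuousOn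
      (continuous_thresholdValue (ys := ys) (c := c) (al := al) (m := m) (K := K)).continuousOn
    exact .of_continuousOn_of_bound hPc fun t ht =>
      hC _ ⟨hY.nonneg t ht, (le_abs_self _).trans (hY.abs_le t ht)⟩
  have hQt : IsTame fun t => thresholdValueSlope ys c al m K (y t) := by
    refine ⟨hcross.mono ?_, |c| * y₀ + (|al| * y₀ + |K * m|), 0, fun t ht => ?_⟩
    · rintro t ⟨ht, hnc⟩
      refine ⟨ht, ?_⟩
      by_contra hne
      refine hnc ?_
      have hyc : ContinuousAt y t := hY.continuousOn.continuousAt (Ici_mem_nhds ht)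
      rcases lt_or_gt_of_ne hne with hl | hl
      · refine (hyc.const_mul c).congr ?_
        filter_upwards [hyc.eventually (gt_mem_nhds hl)] with s hs
        rw [thresholdValueSlope, if_pos hs]
      · have h1 : ContinuousAt (fun s => al * y s - K * m * (max (y s / ys) 1) ^ (-m)) t := by
          refine (hyc.const_mul al).sub (ContinuousAt.const_mul ?_ _)
          refine ContinuousAt.rpow_const ?_ (Or.inl ?_)
          · exact (hyc.div_const ys).max continuousAt_const
          · exact ne_of_gt (zero_lt_one.trans_le (le_max_right _ _))
        refine h1.congr ?_
        filter_upwards [hyc.eventually (lt_mem_nhds hl)] with s hs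
        rw [thresholdValueSlope, if_neg (not_lt.2 hs.le)]
    · have hyt := hY.abs_le t ht
      have h1 : |c * y t| ≤ |c| * y₀ := by rw [abs_mul]; gcongr
      have h2 : |al * y t| ≤ |al| * y₀ := by rw [abs_mul]; gcongr
      have hw0 : 0 ≤ (max (y t / ys) 1) ^ (-m) :=
        Real.rpow_nonneg (zero_le_one.trans (le_max_right _ _)) _
      have h3 : |K * m * (max (y t / ys) 1) ^ (-m)| ≤ |K * m| := by
        rw [abs_mul, abs_of_nonneg hw0]
        exact mul_le_of_le_one_right (abs_nonneg _) (max_div_rpow_le_one hm0 _)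
      have h4 : 0 ≤ |c| * y₀ := by positivity
      have h5 : 0 ≤ |al| * y₀ := by positivity
      rw [pow_zero, mul_one, thresholdValueSlope]
      split_ifs
      · linarith [abs_nonneg (K * m)]
      · linarith [abs_sub (al * y t) (K * m * (max (y t / ys) 1) ^ (-m))]
  have hft : IsTame fun t => -(a t * thresholdValueSlope ys c al m K (y t)) := (hat.mul hQt).neg
  have hb := IsTame.integral_discounted_deriv hp hPt hPc hft
    ((hq.isTame.countable_disc.union hv.isTame.countable_disc).union hcross) (fun t ht hts => by
      simp only [mem_union, mem_ofPred_eq, not_or, not_and, not_not] at hts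
      exact hasDerivAt_thresholdValue_comp hys (hd0 t ht (hts.1.1 ht) (hts.1.2 ht)) (hts.2 ht))
  rw [hy0] at hb
  have i1 := (isTame_costRate (lam := lam) (gam := gam) (umin := umin) hv.isTame
    hY.isTame).integrableOn_discounted hp
  have i2 := (hft.sub (hPt.const_mul p)).integrableOn_discounted hp
  have hae : ∀ᵐ t ∂volume.restrict (Ioi 0), 0 < t ∧ y t ≠ ys := by
    have h1 : ∀ᵐ t ∂volume.restrict (Ioi (0 : ℝ)), t ∉ {t | 0 < t ∧ y t = ys} :=
      measure_eq_zero_iff_ae_notMem.1 (hcross.measure_zero _)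
    filter_upwards [ae_restrict_mem measurableSet_Ioi, h1] with t ht h1
    exact ⟨ht, fun he => h1 ⟨ht, he⟩⟩
  have hjb : ∀ t, 0 < t → y t ≠ ys → _ := fun t ht hne =>
    hamiltonJacobiBellman hp hn hlam humin hu hys h (hv.mem t ht.le) hne (hlow t ht.le)
      (hhigh t ht.le)
  rw [← hb, playerCost]
  refine ⟨integral_mono_ae i2 i1 ?_, fun hvq => integral_congr_ae ?_⟩
  · filter_upwards [hae] with t ht
    refine mul_le_mul_of_nonneg_left ?_ (Real.exp_pos _).le
    have := (hjb t ht.1 ht.2).1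
    simp only [ha]
    linarith
  · filter_upwards [hae] with t ht
    have := (hjb t ht.1 ht.2).2 (hvq t ht.1.le)
    simp only [ha]
    congr 1
    linarith

end thresholdValue

/-! ### Step controls and threshold laws -/

lemma isPiecewiseContinuous_of_step {f : ℝ → ℝ} {a b c : ℝ}
    (ha : ∀ t, 0 ≤ t → t < c → f t = a) (hb : ∀ t, 0 ≤ t → c < t → f t = b) :
    IsPiecewiseContinuous f where
  finite_jumps := fun T => by
    refine (finite_singleton c).subset ?_
    rintro t ⟨ht, hnc⟩
    by_contra hne
    refine hnc ?_
    rcases lt_or_gt_of_ne hne with h | h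
    · refine (continuousWithinAt_const (b := a)).congr_of_eventuallyEq ?_ (ha t ht.1 h)
      filter_upwards [self_mem_nhdsWithin, mem_nhdsWithin_of_mem_nhds (gt_mem_nhds h)] with s h1 h2
        using ha s h1 h2
    · refine (continuousWithinAt_const (b := b)).congr_of_eventuallyEq ?_ (hb t ht.1 h)
      filter_upwards [self_mem_nhdsWithin, mem_nhdsWithin_of_mem_nhds (lt_mem_nhds h)] with s h1 h2
        using hb s h1 h2
  left_limit := fun t ht => by
    rcases le_or_gt t c with h | h
    · refine ⟨a, tendsto_const_nhds.congr' ?_⟩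
      filter_upwards [self_mem_nhdsWithin, mem_nhdsWithin_of_mem_nhds (lt_mem_nhds ht)] with s h1 h2
        using (ha s (le_of_lt h2) (lt_of_lt_of_le h1 h)).symm
    · refine ⟨b, tendsto_const_nhds.congr' ?_⟩
      filter_upwards [mem_nhdsWithin_of_mem_nhds (lt_mem_nhds ht),
        mem_nhdsWithin_of_mem_nhds (lt_mem_nhds h)] with s h1 h2
        using (hb s (le_of_lt h1) h2).symm
  right_limit := fun t ht => by
    rcases lt_or_ge t c with h | h
    · refine ⟨a, tendsto_const_nhds.congr' ?_⟩
      filter_upwards [self_mem_nhdsWithin, mem_nhdsWithin_of_mem_nhds (gt_mem_nhds h)] with s h1 h2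
        using (ha s (ht.trans (le_of_lt h1)) h2).symm
    · refine ⟨b, tendsto_const_nhds.congr' ?_⟩
      filter_upwards [self_mem_nhdsWithin] with s h1
        using (hb s (ht.trans (le_of_lt h1)) (lt_of_le_of_lt h h1)).symm

lemma IsPiecewiseContinuous.mix {f g : ℝ → ℝ} (hf : IsPiecewiseContinuous f)
    (hg : IsPiecewiseContinuous g) (ε : ℝ) :
    IsPiecewiseContinuous fun t => f t + ε * (g t - f t) where
  finite_jumps := fun T => by
    refine ((hf.finite_jumps T).union (hg.finite_jumps T)).subset ?_
    rintro t ⟨ht, hnc⟩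
    by_contra h
    simp only [mem_union, mem_ofPred_eq, not_or, not_and, not_not] at h
    exact hnc ((h.1 ht).add (continuousWithinAt_const.mul ((h.2 ht).sub (h.1 ht))))
  left_limit := fun t ht => by
    obtain ⟨a, ha⟩ := hf.left_limit t ht
    obtain ⟨b, hb⟩ := hg.left_limit t ht
    exact ⟨_, ha.add ((hb.sub ha).const_mul ε)⟩
  right_limit := fun t ht => by
    obtain ⟨a, ha⟩ := hf.right_limit t ht
    obtain ⟨b, hb⟩ := hg.right_limit t ht
    exact ⟨_, ha.add ((hb.sub ha).const_mul ε)⟩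

/-- Functions that agree almost everywhere on `[0, ∞)` agree where both are continuous. -/
lemma eq_of_ae_eq_of_continuousWithinAt {f g : ℝ → ℝ}
    (h : ∀ᵐ s ∂volume.restrict (Ioi (0 : ℝ)), f s = g s) {t : ℝ} (ht : 0 ≤ t)
    (hf : ContinuousWithinAt f (Ici 0) t) (hg : ContinuousWithinAt g (Ici 0) t) : f t = g t := by
  by_contra hne
  have hsub : Ioi t ⊆ Ici (0 : ℝ) := fun s hs => ht.trans (le_of_lt hs)
  have h1 : ∀ᶠ s in 𝓝[>] t, f s - g s ≠ 0 :=
    ((hf.mono hsub).sub (hg.mono hsub)).eventually_ne (sub_ne_zero.2 hne)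
  obtain ⟨d, hd, hsd⟩ := mem_nhdsGT_iff_exists_Ioo_subset.1 h1
  rw [ae_restrict_iff' measurableSet_Ioi] at h
  have h2 : volume (Ioo t d) = 0 := by
    refine measure_mono_null (fun s hs => ?_) h
    exact fun hc => hsd hs (sub_eq_zero.2 (hc (lt_of_le_of_lt ht hs.1)))
  rw [Real.volume_Ioo, ENNReal.ofReal_eq_zero] at h2
  have : t < d := hd
  linarith

namespace ContentGame

variable {N : ℕ} {G : ContentGame N} {c : ℝ} {φ : ℝ → ℝ}

lemma IsThresholdLaw.mem (hφ : G.IsThresholdLaw c φ) (hu : G.umin ≤ G.umax) (x : ℝ) :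
    φ x ∈ Icc G.umin G.umax := by
  rcases lt_trichotomy x c with h | h | h
  · rw [hφ.1 x h]
    exact ⟨hu, le_rfl⟩
  · rw [h]
    exact hφ.2.2
  · rw [hφ.2.1 x h]
    exact ⟨le_rfl, hu⟩

lemma IsThresholdLaw.antitone (hφ : G.IsThresholdLaw c φ) (hu : G.umin ≤ G.umax) :
    Antitone φ := by
  intro x y hxy
  rcases hxy.eq_or_lt with rfl | hlt
  · exact le_rfl
  rcases lt_or_ge x c with h | h
  · rw [hφ.1 x h]
    exact (hφ.mem hu y).2
  · rw [hφ.2.1 y (h.trans_lt hlt)]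
    exact (hφ.mem hu x).1

lemma isTameControl_of_mem_controls (hu : 0 ≤ G.umin) {v : ℝ → ℝ} (hv : v ∈ G.controls) :
    IsTameControl G.umin G.umax v :=
  ⟨hv.1.isTame (C := G.umax) fun t ht => by
    rw [abs_of_nonneg (hu.trans (hv.2 t ht).1)]
    exact (hv.2 t ht).2, hv.2⟩

lemma mix_mem_controls {v b : ℝ → ℝ} (hv : v ∈ G.controls) (hb : b ∈ G.controls) {ε : ℝ}
    (h0 : 0 ≤ ε) (h1 : ε ≤ 1) : (fun s => v s + ε * (b s - v s)) ∈ G.controls := by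
  refine ⟨hv.1.mix hb.1 ε, fun t ht => ?_⟩
  obtain ⟨h2, h3⟩ := hv.2 t ht
  obtain ⟨h4, h5⟩ := hb.2 t ht
  constructor <;> nlinarith

/-! ### The game with identical players -/

section identical

variable {lam gam p umin umax ys : ℝ} {z : Fin N → ℝ} {w x : Fin N → ℝ → ℝ} {i : Fin N}
  {u v q : ℝ → ℝ}

lemma sum_eq_deviationRate {f : Fin N → ℝ} {a b : ℝ} (hi : f i = a) (hj : ∀ j, j ≠ i → f j = b) :
    ∑ j, f j = a + ((N : ℝ) - 1) * b := by
  rw [← Finset.add_sum_erase _ _ (Finset.mem_univ i), hi,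
    Finset.sum_congr rfl fun j hj' => hj j (Finset.ne_of_mem_erase hj'), Finset.sum_const,
    Finset.card_erase_of_mem (Finset.mem_univ i), Finset.card_univ, Fintype.card_fin, nsmul_eq_mul,
    Nat.cast_sub (Nat.one_le_of_lt i.pos), Nat.cast_one]

lemma one_sub_total_eq_deviationState
    (hx : (identical N lam gam p umin umax z).IsTrajectory w x) (hv : IsTame v) (hq : IsTame q)
    (hi : ∀ t, 0 ≤ t → w i t = v t) (hj : ∀ j, j ≠ i → ∀ t, 0 ≤ t → w j t = q t) {t : ℝ}
    (ht : 0 ≤ t) : 1 - total x t = deviationState N lam (1 - ∑ i, z i) q v t := by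
  have hw : ∀ j, IsTame (w j) := fun j => by
    by_cases h : j = i
    · rw [h]
      exact hv.congr hi
    · exact hq.congr (hj j h)
  rw [hx.one_sub_total_eq_decay hw ht]
  refine decay_congr ?_ ht
  filter_upwards [ae_restrict_mem measurableSet_Ioi] with s hs
  refine sum_eq_deviationRate (i := i) ?_ fun j hne => ?_
  · rw [hi s (le_of_lt hs)]
    rfl
  · rw [hj j hne s (le_of_lt hs)]
    rfl

lemma cost_eq_playerCost {y : ℝ → ℝ} (hi : ∀ t, 0 ≤ t → w i t = v t)
    (hy : ∀ t, 0 ≤ t → 1 - total x t = y t) :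
    (identical N lam gam p umin umax z).cost w x i = playerCost p lam gam umin v y := by
  refine setIntegral_congr_fun measurableSet_Ioi fun s (hs : 0 < s) => ?_
  simp only [rate, hi s hs.le, hy s hs.le]
  rfl

lemma exists_isTrajectory_identical (hlam : 0 ≤ lam) (hz1 : ∑ i, z i ≤ 1)
    (hw : ∀ j, IsTame (w j)) (hw0 : ∀ j t, 0 ≤ t → 0 ≤ w j t) :
    ∃ x, (identical N lam gam p umin umax z).IsTrajectory w x :=
  exists_isTrajectory hw hz1 fun t ht => Finset.sum_nonneg fun j _ => mul_nonneg hlam (hw0 j t ht)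

/-- Nash equilibrium for a symmetric profile, in terms of the cost of a single player. -/
lemma isNash_identical_iff (hN : 1 ≤ N) (hlam : 0 ≤ lam) (humin : 0 ≤ umin)
    (hz1 : ∑ i, z i ≤ 1) :
    (identical N lam gam p umin umax z).IsNash (fun _ => u) ↔
      u ∈ (identical N lam gam p umin umax z).controls ∧
      ∀ v ∈ (identical N lam gam p umin umax z).controls,
        playerCost p lam gam umin u (deviationState N lam (1 - ∑ i, z i) u u) ≤
          playerCost p lam gam umin v (deviationState N lam (1 - ∑ i, z i) u v) := by
  have htame : ∀ v ∈ (identical N lam gam p umin umax z).controls, IsTameControl umin umax v :=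
    fun v hv => isTameControl_of_mem_controls (G := identical N lam gam p umin umax z) humin hv
  have hself : ∀ x, (identical N lam gam p umin umax z).IsTrajectory (fun _ => u) x →
      u ∈ (identical N lam gam p umin umax z).controls → ∀ i,
      (identical N lam gam p umin umax z).cost (fun _ => u) x i =
        playerCost p lam gam umin u (deviationState N lam (1 - ∑ i, z i) u u) :=
    fun x hx hu i => cost_eq_playerCost (fun _ _ => rfl) fun t ht =>
      one_sub_total_eq_deviationState (i := i) hx (htame u hu).isTame (htame u hu).isTame
        (fun _ _ => rfl) (fun _ _ _ _ => rfl) ht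
  have hdev : ∀ i v x, (identical N lam gam p umin umax z).IsTrajectory
      (Function.update (fun _ => u) i v) x →
      u ∈ (identical N lam gam p umin umax z).controls →
      v ∈ (identical N lam gam p umin umax z).controls →
      (identical N lam gam p umin umax z).cost (Function.update (fun _ => u) i v) x i =
        playerCost p lam gam umin v (deviationState N lam (1 - ∑ i, z i) u v) :=
    fun i v x hx hu hv => by
      have hi : ∀ t, 0 ≤ t → Function.update (fun _ : Fin N => u) i v i t = v t := by simp
      exact cost_eq_playerCost hi fun t ht =>
        one_sub_total_eq_deviationState (i := i) hx (htame v hv).isTame (htame u hu).isTame hi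
          (fun j hj t _ => by rw [Function.update_of_ne hj]) ht
  constructor
  · rintro ⟨hu, hle⟩
    have i : Fin N := ⟨0, hN⟩
    have hui := hu i
    refine ⟨hui, fun v hv => ?_⟩
    have hnn : ∀ v ∈ (identical N lam gam p umin umax z).controls, ∀ t, 0 ≤ t → 0 ≤ v t :=
      fun v hv t ht => humin.trans ((htame v hv).mem t ht).1
    obtain ⟨x, hx⟩ := exists_isTrajectory_identical (gam := gam) (p := p) (umin := umin)
      (umax := umax) (w := fun _ => u) hlam hz1 (fun _ => (htame u hui).isTame) fun _ => hnn u hui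
    have hupd : ∀ j, Function.update (fun _ : Fin N => u) i v j ∈
        (identical N lam gam p umin umax z).controls := fun j => by
      by_cases h : j = i
      · rw [h, Function.update_self]
        exact hv
      · rw [Function.update_of_ne h]
        exact hui
    obtain ⟨x', hx'⟩ := exists_isTrajectory_identical (gam := gam) (p := p) (umin := umin)
      (umax := umax) (w := Function.update (fun _ => u) i v) hlam hz1
      (fun j => (htame _ (hupd j)).isTame) fun j => hnn _ (hupd j)
    have := hle x hx i v hv x' hx'
    rwa [hself x hx hui, hdev i v x' hx' hui hv] at this
  · rintro ⟨hu, hle⟩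
    refine ⟨fun _ => hu, fun x hx i v hv x' hx' => ?_⟩
    rw [hself x hx hu, hdev i v x' hx' hu hv]
    exact hle v hv

end identical

end ContentGame

/-! ### Symmetric equilibria -/

/-- The parameters of `n` identical players, together with the threshold level `ys` of the fraction
of viewers still to be reached: at `ys`, the marginal value of acceleration equals its marginal cost
if all players use `umin` from then on. -/
structure ThresholdSetting (n lam gam p umin umax ys : ℝ) : Prop where
  one_le : 1 ≤ n
  lam_pos : 0 < lam
  gam_pos : 0 < gam
  p_pos : 0 < p
  umin_pos : 0 < umin
  umin_lt_umax : umin < umax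
  ys_pos : 0 < ys
  steady : lam * (steadyFactor p n (n * lam * umin) * ys) = gam

namespace ThresholdSetting

variable {n lam gam p umin umax ys y₀ c : ℝ} {u v : ℝ → ℝ}

lemma rate_pos (h : ThresholdSetting n lam gam p umin umax ys) : 0 < n * lam * umin :=
  mul_pos (mul_pos (zero_lt_one.trans_le h.one_le) h.lam_pos) h.umin_pos

lemma decaysAtRate (h : ThresholdSetting n lam gam p umin umax ys) (hy : 0 ≤ y₀)
    (hu : IsTameControl umin umax u) :
    DecaysAtRate (n * lam * umin) y₀ (deviationState n lam y₀ u u) :=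
  decaysAtRate_deviationState h.one_le h.lam_pos.le h.umin_pos.le hy hu hu

lemma lam_mul_marginalValue_le (h : ThresholdSetting n lam gam p umin umax ys) (hy : 0 ≤ y₀)
    (hu : IsTameControl umin umax u) {t : ℝ} (ht : 0 ≤ t) :
    ys * (lam * marginalValue p n (deviationState n lam y₀ u u) t) ≤
      gam * deviationState n lam y₀ u u t := by
  have h1 := (h.decaysAtRate hy hu).marginalValue_le h.p_pos h.rate_pos.le h.one_le ht
  have h2 := mul_le_mul_of_nonneg_left h1 (mul_pos h.ys_pos h.lam_pos).le
  rw [← h.steady]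
  linarith

lemma lam_mul_marginalValue_eq (h : ThresholdSetting n lam gam p umin umax ys)
    (hu : IsTameControl umin umax u) {t : ℝ} (ht : 0 ≤ t)
    (hlow : ∀ᵐ s ∂volume.restrict (Ioi t), u s = umin) :
    ys * (lam * marginalValue p n (deviationState n lam y₀ u u) t) =
      gam * deviationState n lam y₀ u u t := by
  have h1 : marginalValue p n (deviationState n lam y₀ u u) t =
      steadyFactor p n (n * lam * umin) * deviationState n lam y₀ u u t := by
    refine marginalValue_eq_of_decay (by linarith [h.rate_pos, h.p_pos]) fun r hr => ?_
    rw [deviationState, decay_eq_of_ae (k := n * lam * umin)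
      (isTame_deviationRate hu.isTame hu.isTame) ht ?_ (show t ≤ t + r by linarith),
      add_sub_cancel_left]
    filter_upwards [hlow] with s hs
    rw [hs]
    ring
  rw [h1, ← h.steady]
  ring

lemma continuousOn_state (hu : IsTame u) : ContinuousOn (deviationState n lam y₀ u u) (Ici 0) :=
  continuousOn_decay (isTame_deviationRate hu hu)

/-- Before the switching time the marginal value exceeds the cost, so the state is above the
threshold; after it, the control is minimal, so the marginal value is proportional to the state,
which is below the threshold. -/
lemma threshold_of_step (h : ThresholdSetting n lam gam p umin umax ys) (hy : 0 ≤ y₀)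
    (hv : IsTameControl umin umax v) (hc : 0 ≤ c)
    (hbefore : ∀ s, 0 ≤ s → s < c →
      gam / lam < marginalValue p n (deviationState n lam y₀ v v) s)
    (hafter : ∀ s, c < s → marginalValue p n (deviationState n lam y₀ v v) s < gam / lam)
    (hlow : ∀ᵐ s ∂volume.restrict (Ioi c), v s = umin) :
    (∀ s, 0 ≤ s → s < c → ys < deviationState n lam y₀ v v s) ∧
      ∀ s, c < s → deviationState n lam y₀ v v s < ys := by
  refine ⟨fun s hs hsc => ?_, fun s hs => ?_⟩
  · have h1 := hbefore s hs hsc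
    rw [div_lt_iff₀ h.lam_pos] at h1
    have h2 := h.lam_mul_marginalValue_le hy hv hs
    have h3 := mul_lt_mul_of_pos_left h1 h.ys_pos
    have h4 : gam * ys < gam * deviationState n lam y₀ v v s := by linarith
    exact lt_of_mul_lt_mul_left h4 h.gam_pos.le
  · have h1 := hafter s hs
    rw [lt_div_iff₀ h.lam_pos] at h1
    have h2 := h.lam_mul_marginalValue_eq (y₀ := y₀) hv (hc.trans hs.le)
      (ae_restrict_of_ae_restrict_of_subset (Ioi_subset_Ioi hs.le) hlow)
    have h3 := mul_lt_mul_of_pos_left h1 h.ys_pos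
    have h4 : gam * deviationState n lam y₀ v v s < gam * ys := by linarith
    exact lt_of_mul_lt_mul_left h4 h.gam_pos.le

/-- The first-order condition holds for a control that switches from `umax` to `umin` when the state
reaches the threshold level. -/
lemma first_order_of_step (h : ThresholdSetting n lam gam p umin umax ys) (hy : 0 ≤ y₀)
    (hu : IsTameControl umin umax u) (hv : IsTameControl umin umax v) (hc : 0 ≤ c)
    (hmax : ∀ s, 0 ≤ s → s < c → u s = umax) (hmin : ∀ s, c < s → u s = umin)
    (hcross : 0 < c → deviationState n lam y₀ u u c = ys)
    (hbelow : ∀ s, c < s → deviationState n lam y₀ u u s < ys) :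
    ∀ᵐ s ∂volume.restrict (Ioi 0),
      0 ≤ (gam - lam * marginalValue p n (deviationState n lam y₀ u u) s) * (v s - u s) := by
  have hne : ∀ᵐ s ∂volume.restrict (Ioi (0 : ℝ)), s ≠ c :=
    ae_restrict_of_ae (measure_eq_zero_iff_ae_notMem.1 (measure_singleton c))
  filter_upwards [ae_restrict_mem measurableSet_Ioi, hne] with s hs hsc
  have hs0 : 0 ≤ s := le_of_lt hs
  obtain ⟨h1, h2⟩ := hv.mem s hs0
  rcases lt_or_gt_of_ne hsc with hlt | hgt
  · have hY := h.decaysAtRate hy hu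
    have h3 := h.lam_mul_marginalValue_eq (y₀ := y₀) hu hc (by
      filter_upwards [ae_restrict_mem measurableSet_Ioi] with s hs using hmin s hs)
    rw [hcross (hs0.trans_lt hlt), mul_comm gam] at h3
    have h4 := mul_left_cancel₀ h.ys_pos.ne' h3
    have h5 := hY.marginalValue_le_exp_mul h.p_pos h.one_le hs0 hlt.le
    have h6 : Real.exp (-(n * lam * umin * (c - s))) ≤ 1 := by
      rw [Real.exp_le_one_iff]
      have := mul_nonneg h.rate_pos.le (sub_nonneg.2 hlt.le)
      linarith
    have h7 := mul_le_mul_of_nonneg_right h6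
      (hY.marginalValue_nonneg h.p_pos h.one_le hs0)
    have h8 := mul_le_mul_of_nonneg_left (h5.trans h7) h.lam_pos.le
    rw [hmax s hs0 hlt]
    exact mul_nonneg_of_nonpos_of_nonpos (by linarith) (by linarith)
  · have h3 := h.lam_mul_marginalValue_le hy hu hs0
    have h4 := mul_lt_mul_of_pos_left (hbelow s hgt) h.gam_pos
    have h5 : ys * (lam * marginalValue p n (deviationState n lam y₀ u u) s) ≤ ys * gam := by
      linarith
    have h6 := le_of_mul_le_mul_left h5 h.ys_pos
    rw [hmin s hgt]
    exact mul_nonneg (by linarith) (by linarith)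

/-- Two symmetric profiles generated by the same threshold law have the same state: the rate of
decay is monotone in the state, so the states cannot separate. -/
lemma state_le_state (h : ThresholdSetting n lam gam p umin umax ys) (hy : 0 ≤ y₀)
    (hu : IsTameControl umin umax u) (hv : IsTameControl umin umax v) {φ : ℝ → ℝ}
    (hφ : Antitone φ)
    (hue : ∀ᵐ s ∂volume.restrict (Ioi 0), u s = φ (1 - deviationState n lam y₀ u u s))
    (hve : ∀ᵐ s ∂volume.restrict (Ioi 0), v s = φ (1 - deviationState n lam y₀ v v s)) {t : ℝ}
    (ht : 0 ≤ t) : deviationState n lam y₀ v v t ≤ deviationState n lam y₀ u u t := by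
  have hk := h.rate_pos.le
  have hr : ∀ {w : ℝ → ℝ}, IsTameControl umin umax w →
      ∀ t, 0 ≤ t → 0 ≤ lam * w t + (n - 1) * (lam * w t) := fun hw t ht =>
    hk.trans (le_deviationRate h.one_le h.lam_pos.le hw hw ht)
  refine le_of_forall_increment_le (continuousOn_state hv.isTame) (continuousOn_state hu.isTame)
    (by simp [deviationState]) (fun s t hs hst hlt => ?_) ht
  have ht := hs.trans hst.le
  have tu := isTame_deviationRate (n := n) (lam := lam) hu.isTame hu.isTame
  have tv := isTame_deviationRate (n := n) (lam := lam) hv.isTame hv.isTame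
  have eu := decay_eq_sub_integral tu hy (hr hu) hs hst.le
  have ev := decay_eq_sub_integral tv hy (hr hv) hs hst.le
  simp only [deviationState] at hlt hue hve ⊢
  rw [eu, ev, neg_le_neg_iff, intervalIntegral.integral_of_le hst.le,
    intervalIntegral.integral_of_le hst.le]
  refine integral_mono_ae
    (((tu.mul (isTame_decay tu hy (hr hu))).intervalIntegrable hs ht).1)
    (((tv.mul (isTame_decay tv hy (hr hv))).intervalIntegrable hs ht).1) ?_
  have hsub : Ioc s t ⊆ Ioi (0 : ℝ) := fun r hr => lt_of_le_of_lt hs hr.1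
  filter_upwards [ae_restrict_of_ae_restrict_of_subset hsub hue,
    ae_restrict_of_ae_restrict_of_subset hsub hve, ae_restrict_mem measurableSet_Ioc]
    with r h1 h2 h3
  have hr0 : 0 ≤ r := hs.trans h3.1.le
  have h4 := hlt r h3
  have h5 : u r ≤ v r := by
    rw [h1, h2]
    exact hφ (by linarith)
  have h6 : lam * u r + (n - 1) * (lam * u r) ≤ lam * v r + (n - 1) * (lam * v r) := by
    have h7 := mul_le_mul_of_nonneg_left h5 h.lam_pos.le
    have h8 := mul_le_mul_of_nonneg_left h7 (sub_nonneg.2 h.one_le)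
    linarith
  exact mul_le_mul h6 h4.le (decay_nonneg hy r) (hr hv r hr0)

/-- The time at which the state reaches the threshold level if `umax` is used until then. -/
lemma exists_step (h : ThresholdSetting n lam gam p umin umax ys) (hy : 0 ≤ y₀) :
    ∃ c, 0 ≤ c ∧
      (∀ s, 0 ≤ s → s < c → ys < deviationState n lam y₀ (fun t => if t < c then umax else umin)
        (fun t => if t < c then umax else umin) s) ∧
      (∀ s, c < s → deviationState n lam y₀ (fun t => if t < c then umax else umin)
        (fun t => if t < c then umax else umin) s < ys) ∧
      (0 < c → deviationState n lam y₀ (fun t => if t < c then umax else umin)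
        (fun t => if t < c then umax else umin) c = ys) := by
  have hstep : ∀ c, IsTameControl umin umax fun t : ℝ => if t < c then umax else umin := fun c => by
    have hmem : ∀ t : ℝ, (if t < c then umax else umin) ∈ Icc umin umax := fun t => by
      split_ifs
      · exact ⟨h.umin_lt_umax.le, le_rfl⟩
      · exact ⟨le_rfl, h.umin_lt_umax.le⟩
    refine ⟨IsPiecewiseContinuous.isTame (isPiecewiseContinuous_of_step (c := c)
      (fun t _ ht => if_pos ht) (fun t _ ht => if_neg (not_lt.2 ht.le))) (C := umax)
      fun t _ => ?_, fun t _ => hmem t⟩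
    rw [abs_of_nonneg (h.umin_pos.le.trans (hmem t).1)]
    exact (hmem t).2
  have hlt : ∀ c s t, 0 < y₀ → 0 ≤ s → s < t →
      deviationState n lam y₀ (fun t => if t < c then umax else umin)
        (fun t => if t < c then umax else umin) t <
      deviationState n lam y₀ (fun t => if t < c then umax else umin)
        (fun t => if t < c then umax else umin) s := fun c s t hy0 hs hst =>
    decay_lt (isTame_deviationRate (hstep c).isTame (hstep c).isTame) hy0 h.rate_pos
      (fun t ht => le_deviationRate h.one_le h.lam_pos.le (hstep c) (hstep c) ht) hs hst
  rcases le_or_gt y₀ ys with hle | hgt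
  · refine ⟨0, le_rfl, fun s h1 h2 => absurd h1 (not_le.2 h2), fun s hs => ?_,
      fun h0 => by simp at h0⟩
    rcases hy.eq_or_lt with rfl | hy0
    · simpa [deviationState, decay] using h.ys_pos
    · refine (hlt 0 0 s hy0 le_rfl hs).trans_le ?_
      simpa [deviationState] using hle
  · have hy0 : 0 < y₀ := h.ys_pos.trans hgt
    have hk : 0 < n * lam * umax :=
      mul_pos (mul_pos (zero_lt_one.trans_le h.one_le) h.lam_pos) (h.umin_pos.trans h.umin_lt_umax)
    set c := Real.log (y₀ / ys) / (n * lam * umax) with hc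
    have hc0 : 0 < c := div_pos (Real.log_pos ((one_lt_div h.ys_pos).2 hgt)) hk
    have hcross : deviationState n lam y₀ (fun t => if t < c then umax else umin)
        (fun t => if t < c then umax else umin) c = ys := by
      have h1 : ∫ s in (0 : ℝ)..c, (lam * (if s < c then umax else umin) +
          (n - 1) * (lam * (if s < c then umax else umin))) = c * (n * lam * umax) := by
        rw [intervalIntegral.integral_congr_Ioo_of_le (g := fun _ => n * lam * umax) hc0.le]
        · rw [intervalIntegral.integral_const, sub_zero, smul_eq_mul]
        · intro s hs
          simp only [if_pos hs.2]
          ring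
      rw [deviationState, decay, h1, hc, div_mul_cancel₀ _ hk.ne', Real.exp_neg,
        Real.exp_log (div_pos hy0 h.ys_pos), inv_div, mul_div_cancel₀ _ hy0.ne']
    refine ⟨c, hc0.le, fun s hs hsc => ?_, fun s hs => ?_, fun _ => hcross⟩
    · exact hcross ▸ hlt c s c hy0 hs hsc
    · exact (hlt c c s hy0 hc0.le hs).trans_eq hcross

end ThresholdSetting

/-! ### Existence and uniqueness of the symmetric equilibrium -/

namespace ContentGame

variable {N : ℕ} {lam gam p umin umax ys : ℝ} {z : Fin N → ℝ} {φ : ℝ → ℝ}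

lemma step_mem_controls (hu : umin ≤ umax) (c : ℝ) :
    (fun t : ℝ => if t < c then umax else umin) ∈
      (identical N lam gam p umin umax z).controls := by
  refine ⟨isPiecewiseContinuous_of_step (c := c) (fun t _ ht => if_pos ht)
    fun t _ ht => if_neg (not_lt.2 ht.le), fun t _ => ?_⟩
  simp only
  split_ifs
  · exact ⟨hu, le_rfl⟩
  · exact ⟨le_rfl, hu⟩

lemma exists_isNash_of_thresholdLaw (hN : 1 ≤ N)
    (h : ThresholdSetting N lam gam p umin umax ys) (hz1 : ∑ i, z i ≤ 1)
    (hφ : (identical N lam gam p umin umax z).IsThresholdLaw (1 - ys) φ) :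
    ∃ u, (∀ t, 0 ≤ t → u t = φ (1 - deviationState N lam (1 - ∑ i, z i) u u t)) ∧
      (identical N lam gam p umin umax z).IsNash (fun _ => u) := by
  have hy : 0 ≤ 1 - ∑ i, z i := by linarith
  have hle : umin ≤ umax := h.umin_lt_umax.le
  obtain ⟨c, hc, habove, hbelow, hcross⟩ := h.exists_step hy
  set U : ℝ → ℝ := fun t => if t < c then umax else umin with hU
  -- the law applied to the state of the step control `U` changes `U` at most at the time `c`
  set u : ℝ → ℝ := fun t => φ (1 - deviationState N lam (1 - ∑ i, z i) U U t) with hudef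
  have hmax : ∀ t, 0 ≤ t → t < c → u t = umax := fun t ht htc =>
    hφ.1 _ (by linarith [habove t ht htc])
  have hmin : ∀ t, c < t → u t = umin := fun t htc => hφ.2.1 _ (by linarith [hbelow t htc])
  have huc : u ∈ (identical N lam gam p umin umax z).controls :=
    ⟨isPiecewiseContinuous_of_step hmax fun t _ => hmin t, fun t _ => hφ.mem hle _⟩
  have hut : IsTameControl umin umax u :=
    isTameControl_of_mem_controls (G := identical N lam gam p umin umax z) h.umin_pos.le huc
  have hstate : ∀ t, 0 ≤ t → deviationState N lam (1 - ∑ i, z i) u u t =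
      deviationState N lam (1 - ∑ i, z i) U U t := by
    intro t ht
    refine decay_congr ?_ ht
    have hne : ∀ᵐ s ∂volume.restrict (Ioi (0 : ℝ)), s ≠ c :=
      ae_restrict_of_ae (measure_eq_zero_iff_ae_notMem.1 (measure_singleton c))
    filter_upwards [ae_restrict_mem measurableSet_Ioi, hne] with s hs hsc
    have : u s = U s := by
      rcases lt_or_gt_of_ne hsc with hlt | hgt
      · rw [hmax s (le_of_lt hs) hlt, hU]
        exact (if_pos hlt).symm
      · rw [hmin s hgt, hU]
        exact (if_neg (not_lt.2 hgt.le)).symm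
    rw [this]
  refine ⟨u, fun t ht => by rw [hstate t ht], (isNash_identical_iff hN h.lam_pos.le h.umin_pos.le
    hz1).2 ⟨huc, fun v hv => ?_⟩⟩
  have hvt : IsTameControl umin umax v :=
    isTameControl_of_mem_controls (G := identical N lam gam p umin umax z) h.umin_pos.le hv
  refine playerCost_le_of_first_order h.p_pos h.one_le h.lam_pos.le h.umin_pos.le hy hut hvt
    (h.first_order_of_step hy hut hvt hc hmax hmin (fun h0 => ?_) fun s hs => ?_)
  · rw [hstate c hc, hcross h0]
  · rw [hstate s (hc.trans hs.le)]
    exact hbelow s hs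

/-- A symmetric equilibrium control is bang-bang, switching when the marginal value falls to the
marginal cost; hence it follows the threshold law. -/
lemma IsNash.ae_eq_thresholdLaw (hN : 1 ≤ N) (h : ThresholdSetting N lam gam p umin umax ys)
    (hz1 : ∑ i, z i ≤ 1) (hφ : (identical N lam gam p umin umax z).IsThresholdLaw (1 - ys) φ)
    {v : ℝ → ℝ} (hv : (identical N lam gam p umin umax z).IsNash (fun _ => v)) :
    ∀ᵐ s ∂volume.restrict (Ioi 0),
      v s = φ (1 - deviationState N lam (1 - ∑ i, z i) v v s) := by
  have hy : 0 ≤ 1 - ∑ i, z i := by linarith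
  obtain ⟨hvc, hbest⟩ := (isNash_identical_iff hN h.lam_pos.le h.umin_pos.le hz1).1 hv
  have htame : ∀ w ∈ (identical N lam gam p umin umax z).controls, IsTameControl umin umax w :=
    fun w hw => isTameControl_of_mem_controls (G := identical N lam gam p umin umax z)
      h.umin_pos.le hw
  have hvt := htame v hvc
  have hY := h.decaysAtRate hy hvt
  obtain ⟨c, hc, hbefore, hafter⟩ := hY.exists_switching_time h.p_pos h.rate_pos h.one_le
    (div_pos h.gam_pos h.lam_pos)
  set b : ℝ → ℝ := fun t => if t < c then umax else umin with hb
  have hbc : b ∈ (identical N lam gam p umin umax z).controls :=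
    step_mem_controls h.umin_lt_umax.le c
  have hbt := htame b hbc
  have hint := first_order_of_playerCost_le h.p_pos h.one_le h.lam_pos.le h.umin_pos.le hy hvt hbt
    fun ε h0 h1 => hbest _ (mix_mem_controls hvc hbc h0.le h1)
  have hne : ∀ᵐ s ∂volume.restrict (Ioi (0 : ℝ)), s ≠ c :=
    ae_restrict_of_ae (measure_eq_zero_iff_ae_notMem.1 (measure_singleton c))
  have hnonpos : ∀ s, 0 < s → s ≠ c →
      (gam - lam * marginalValue p N (deviationState N lam (1 - ∑ i, z i) v v) s) *
        (b s - v s) ≤ 0 := by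
    intro s hs hsc
    obtain ⟨h1, h2⟩ := hvt.mem s hs.le
    rcases lt_or_gt_of_ne hsc with hlt | hgt
    · have h3 := hbefore s hs.le hlt
      rw [div_lt_iff₀ h.lam_pos] at h3
      simp only [hb, if_pos hlt]
      exact mul_nonpos_of_nonpos_of_nonneg (by linarith) (by linarith)
    · have h3 := hafter s hgt
      rw [lt_div_iff₀ h.lam_pos] at h3
      simp only [hb, if_neg (not_lt.2 hgt.le)]
      exact mul_nonpos_of_nonneg_of_nonpos (by linarith) (by linarith)
  -- the integrand is nonpositive and its integral nonnegative, so it vanishes almost everywhere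
  have htm : IsTame fun s =>
      (gam - lam * marginalValue p N (deviationState N lam (1 - ∑ i, z i) v v) s) * (b s - v s) :=
    ((IsTame.const gam).sub ((hY.isTame_marginalValue h.p_pos h.rate_pos.le h.one_le).const_mul
      lam)).mul (hbt.isTame.sub hvt.isTame)
  have hi := htm.neg.integrableOn_discounted h.p_pos
  have hnn : 0 ≤ᵐ[volume.restrict (Ioi 0)] fun s => Real.exp (-(p * s)) *
      -((gam - lam * marginalValue p N (deviationState N lam (1 - ∑ i, z i) v v) s) *
        (b s - v s)) := by
    filter_upwards [ae_restrict_mem measurableSet_Ioi, hne] with s hs hsc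
    exact mul_nonneg (Real.exp_pos _).le (neg_nonneg.2 (hnonpos s hs hsc))
  have hzero := (integral_eq_zero_iff_of_nonneg_ae hnn hi).1 (by
    refine le_antisymm ?_ (integral_nonneg_of_ae hnn)
    simp only [mul_neg]
    rw [integral_neg]
    linarith)
  have hvb : ∀ᵐ s ∂volume.restrict (Ioi 0), v s = b s := by
    filter_upwards [hzero, ae_restrict_mem measurableSet_Ioi, hne] with s h0 hs hsc
    have h1 := (mul_eq_zero.1 h0).resolve_left (Real.exp_pos _).ne'
    rw [neg_eq_zero, mul_eq_zero] at h1
    rcases h1 with h1 | h1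
    · exfalso
      rcases lt_or_gt_of_ne hsc with hlt | hgt
      · have h3 := hbefore s (le_of_lt hs) hlt
        rw [div_lt_iff₀ h.lam_pos] at h3
        linarith
      · have h3 := hafter s hgt
        rw [lt_div_iff₀ h.lam_pos] at h3
        linarith
    · linarith
  have hlow : ∀ᵐ s ∂volume.restrict (Ioi c), v s = umin := by
    filter_upwards [ae_restrict_of_ae_restrict_of_subset (Ioi_subset_Ioi hc) hvb,
      ae_restrict_mem measurableSet_Ioi] with s hs hsc
    rw [hs, hb]
    exact if_neg (not_lt.2 (le_of_lt hsc))
  obtain ⟨habove, hbelow⟩ := h.threshold_of_step hy hvt hc hbefore hafter hlow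
  filter_upwards [hvb, ae_restrict_mem measurableSet_Ioi, hne] with s hs hs0 hsc
  rcases lt_or_gt_of_ne hsc with hlt | hgt
  · rw [hs, hφ.1 _ (by linarith [habove s (le_of_lt hs0) hlt])]
    exact if_pos hlt
  · rw [hs, hφ.2.1 _ (by linarith [hbelow s hgt])]
    exact if_neg (not_lt.2 hgt.le)

/-! ### Threshold feedback -/

/-- The total can cross a given level below `1` only once. For a profile that reacts to the state,
this has to be shown before the controls are known to be tame. -/
lemma subsingleton_crossing {w x : Fin N → ℝ → ℝ} (hN : 1 ≤ N) (hlam : 0 < lam) (humin : 0 < umin)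
    (hys : 0 < ys) (hz1 : ∑ i, z i ≤ 1)
    (hx : (identical N lam gam p umin umax z).IsTrajectory w x)
    (hmeas : ∀ j, AEStronglyMeasurable (w j) (volume.restrict (Ioi 0)))
    (hmem : ∀ j t, 0 ≤ t → w j t ∈ Icc umin umax) :
    {t | 0 < t ∧ 1 - total x t = ys}.Subsingleton := by
  set y : ℝ → ℝ := fun t => 1 - total x t with hydef
  have hyc : ContinuousOn y (Ici 0) := continuousOn_const.sub hx.continuousOn_total
  have hwi : ∀ j t, 0 ≤ t → IntervalIntegrable (w j) volume 0 t := by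
    intro j t ht
    rw [intervalIntegrable_iff_integrableOn_Ioc_of_le ht]
    refine IntegrableOn.of_bound (by simp) ((hmeas j).mono_set Ioc_subset_Ioi_self) umax ?_
    filter_upwards [ae_restrict_mem measurableSet_Ioc] with s hs
    obtain ⟨h1, h2⟩ := hmem j s hs.1.le
    rw [Real.norm_eq_abs, abs_of_nonneg (humin.le.trans h1)]
    exact h2
  have hint : ∀ f : ℝ → ℝ, ContinuousOn f (Ici 0) → ∀ t, 0 ≤ t →
      IntervalIntegrable (fun s => (∑ j, lam * w j s) * f s) volume 0 t := by
    intro f hf t ht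
    refine IntervalIntegrable.mul_continuousOn ?_ ?_
    · have e : (fun s => ∑ j, lam * w j s) = ∑ j, fun s => lam * w j s := by
        ext s
        simp
      rw [e]
      exact IntervalIntegrable.sum Finset.univ fun j _ => (hwi j t ht).const_mul lam
    · rw [uIcc_of_le ht]
      exact hf.mono Icc_subset_Ici_self
  have hrate : ∀ j t, 0 ≤ t →
      IntervalIntegrable ((identical N lam gam p umin umax z).rate w x j) volume 0 t := by
    intro j t ht
    refine ((hwi j t ht).const_mul lam).mul_continuousOn ?_
    rw [uIcc_of_le ht]
    exact hyc.mono Icc_subset_Ici_self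
  have hsum : ∀ t, 0 ≤ t → lam * umin ≤ ∑ j, lam * w j t := by
    intro t ht
    have h1 : ∀ j ∈ Finset.univ, lam * umin ≤ lam * w j t := fun j _ =>
      mul_le_mul_of_nonneg_left (hmem j t ht).1 hlam.le
    have i : Fin N := ⟨0, hN⟩
    exact (h1 i (Finset.mem_univ i)).trans (Finset.single_le_sum
      (f := fun j => lam * w j t)
      (fun j hj => (mul_pos hlam humin).le.trans (h1 j hj)) (Finset.mem_univ i))
  have hinc : ∀ s t, 0 ≤ s → s ≤ t → y t - y s = -∫ r in s..t, (∑ j, lam * w j r) * y r := by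
    intro s t hs hst
    have h1 := hx.one_sub_total_eq_sub_integral hrate hs
    have h2 := hx.one_sub_total_eq_sub_integral hrate (hs.trans hst)
    have h3 := intervalIntegral.integral_add_adjacent_intervals (hint y hyc s hs)
      ((hint y hyc s hs).symm.trans (hint y hyc t (hs.trans hst)))
    simp only [identical, hydef] at h1 h2 h3 ⊢
    linarith
  have hy0 : 0 ≤ y 0 := by
    have h1 := hx.one_sub_total_eq_sub_integral hrate le_rfl
    rw [intervalIntegral.integral_same, sub_zero] at h1
    rw [hydef]
    simp only [h1]
    exact sub_nonneg.2 hz1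
  have hnn : ∀ t, 0 ≤ t → 0 ≤ y t := fun t ht => by
    refine le_of_forall_increment_le (f := fun _ => 0) continuousOn_const hyc hy0
      (fun s t hs hst hlt => ?_) ht
    rw [hinc s t hs hst.le, sub_zero, intervalIntegral.integral_of_le hst.le, neg_nonneg]
    refine setIntegral_nonpos measurableSet_Ioc fun r hr => ?_
    have := hsum r (hs.trans hr.1.le)
    exact mul_nonpos_of_nonneg_of_nonpos (by linarith [mul_pos hlam humin]) (hlt r hr).le
  have hanti : ∀ s t, 0 ≤ s → s ≤ t → y t ≤ y s := fun s t hs hst => by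
    have h1 : 0 ≤ ∫ r in s..t, (∑ j, lam * w j r) * y r := by
      rw [intervalIntegral.integral_of_le hst]
      refine setIntegral_nonneg measurableSet_Ioc fun r hr => ?_
      have hr0 := hs.trans hr.1.le
      exact mul_nonneg (by linarith [mul_pos hlam humin, hsum r hr0]) (hnn r hr0)
    linarith [hinc s t hs hst]
  -- if the level `ys` were attained at `s < t`, then `y = ys` on `[s, t]`, although `y' < 0` there
  have key : ∀ s t, 0 < s → s < t → y s = ys → y t = ys → False := by
    intro s t hs hst h1 h2
    have h3 : ∫ _ in s..t, lam * umin * ys ≤ ∫ r in s..t, (∑ j, lam * w j r) * y r := by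
      refine intervalIntegral.integral_mono_on hst.le intervalIntegrable_const
        ((hint y hyc s hs.le).symm.trans (hint y hyc t (hs.le.trans hst.le))) fun r hr => ?_
      have h4 := hanti r t (hs.le.trans hr.1) hr.2
      have h5 := hsum r (hs.le.trans hr.1)
      have h6 := mul_pos hlam humin
      exact mul_le_mul h5 (by linarith) hys.le (by linarith)
    have h7 := hinc s t hs.le hst.le
    rw [intervalIntegral.integral_const, smul_eq_mul] at h3
    have := mul_pos (sub_pos.2 hst) (mul_pos (mul_pos hlam humin) hys)
    linarith
  rintro s ⟨hs, hs1⟩ t ⟨ht, ht1⟩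
  rcases lt_trichotomy s t with hlt | heq | hgt
  · exact (key s t hs hlt hs1 ht1).elim
  · exact heq
  · exact (key t s ht hgt ht1 hs1).elim

lemma IsThresholdLaw.measurable {G : ContentGame N} {c : ℝ} (hφ : G.IsThresholdLaw c φ)
    (hu : G.umin ≤ G.umax) : Measurable φ :=
  (hφ.antitone hu).measurable

lemma exists_isValueCoeff {n : ℝ} (h : ThresholdSetting n lam gam p umin umax ys) :
    ∃ c al m K, IsValueCoeff p n lam gam umin umax ys c al m K := by
  have hn : 0 < n := zero_lt_one.trans_le h.one_le
  have hlam := h.lam_pos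
  have hp := h.p_pos
  have humin := h.umin_pos
  have humax := h.umin_pos.trans h.umin_lt_umax
  have h1 : p + n * lam * umin ≠ 0 := by positivity
  have h2 : p + n * lam * umax ≠ 0 := by positivity
  refine ⟨lam * umin / (p + n * lam * umin), lam * umax / (p + n * lam * umax),
    p / (n * lam * umax), (gam * (umax - umin) - p * (lam * umax / (p + n * lam * umax) -
      lam * umin / (p + n * lam * umin)) * ys) / p, ?_, ?_, ?_, ?_, ?_⟩
  · field_simp
  · field_simp
  · field_simp
  · field_simp
  · rw [← h.steady, steadyFactor]
    field_simp
    ring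

/-- Against opponents who follow the threshold law, no control costs less than minus the value
function, and following the law costs exactly that. -/
lemma cost_of_opponents_follow (hN : 1 ≤ N) (h : ThresholdSetting N lam gam p umin umax ys)
    (hz1 : ∑ i, z i ≤ 1) (hφ : (identical N lam gam p umin umax z).IsThresholdLaw (1 - ys) φ)
    {c al m K : ℝ} (hV : IsValueCoeff p N lam gam umin umax ys c al m K)
    {w x : Fin N → ℝ → ℝ} (hx : (identical N lam gam p umin umax z).IsTrajectory w x) {i : Fin N}
    (hj : ∀ j, j ≠ i → Follows φ w x j)
    (hi : IsTameControl umin umax (w i) ∨ Follows φ w x i) :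
    -thresholdValue ys c al m K (1 - ∑ i, z i) ≤
        (identical N lam gam p umin umax z).cost w x i ∧
      (Follows φ w x i → (identical N lam gam p umin umax z).cost w x i =
        -thresholdValue ys c al m K (1 - ∑ i, z i)) := by
  have hle : umin ≤ umax := h.umin_lt_umax.le
  have hy : 0 ≤ 1 - ∑ i, z i := by linarith
  have hqmem : ∀ t, φ (total x t) ∈ Icc umin umax := fun t => hφ.mem hle _
  have hqm : AEStronglyMeasurable (fun t => φ (total x t)) (volume.restrict (Ioi 0)) :=
    ((hφ.measurable hle).comp_aemeasurable
      ((hx.continuousOn_total.mono Ioi_subset_Ici_self).aemeasurable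
        measurableSet_Ioi)).aestronglyMeasurable
  have hcase : ∀ j, IsTameControl umin umax (w j) ∨ Follows φ w x j := fun j => by
    by_cases hji : j = i
    · exact hji ▸ hi
    · exact Or.inr (hj j hji)
  have hcross := subsingleton_crossing hN h.lam_pos h.umin_pos h.ys_pos hz1 hx
    (fun j => (hcase j).elim (fun ht => ht.isTame.aestronglyMeasurable) fun hf => by
      refine hqm.congr ?_
      filter_upwards [ae_restrict_mem measurableSet_Ioi] with t ht
      exact (hf t (le_of_lt ht)).symm)
    (fun j t ht => (hcase j).elim (fun hc => hc.mem t ht) fun hf => by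
      rw [hf t ht]
      exact hqmem t)
  -- the law along the trajectory is locally constant off the crossing time
  have hq : IsTameControl umin umax fun t => φ (total x t) := by
    refine ⟨⟨hcross.countable.mono ?_, umax, 0, fun t _ => ?_⟩, fun t _ => hqmem t⟩
    · rintro t ⟨ht, hnc⟩
      refine ⟨ht, ?_⟩
      by_contra hne
      refine hnc ?_
      have htc : ContinuousAt (total x) t := hx.continuousOn_total.continuousAt (Ici_mem_nhds ht)
      have hne' : total x t ≠ 1 - ys := fun he => hne (by rw [he]; ring)
      rcases lt_or_gt_of_ne hne' with hl | hl
      · refine (continuousAt_const (y := umax)).congr ?_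
        filter_upwards [htc.eventually (gt_mem_nhds hl)] with s hs using (hφ.1 _ hs).symm
      · refine (continuousAt_const (y := umin)).congr ?_
        filter_upwards [htc.eventually (lt_mem_nhds hl)] with s hs using (hφ.2.1 _ hs).symm
    · rw [pow_zero, mul_one, abs_of_nonneg (h.umin_pos.le.trans (hqmem t).1)]
      exact (hqmem t).2
  have hv : IsTameControl umin umax (w i) := hi.elim id fun hf =>
    ⟨hq.isTame.congr hf, fun t ht => by rw [hf t ht]; exact hqmem t⟩
  have hstate : ∀ t, 0 ≤ t → 1 - total x t =
      deviationState N lam (1 - ∑ i, z i) (fun t => φ (total x t)) (w i) t := fun t ht =>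
    one_sub_total_eq_deviationState hx hv.isTame hq.isTame (fun _ _ => rfl) hj ht
  have hcount : {t | 0 < t ∧ deviationState N lam (1 - ∑ i, z i) (fun t => φ (total x t)) (w i) t =
      ys}.Countable := by
    refine hcross.countable.mono ?_
    rintro t ⟨ht, he⟩
    exact ⟨ht, by rw [hstate t ht.le]; exact he⟩
  have hver := verification h.p_pos h.one_le h.lam_pos h.umin_pos h.umin_lt_umax h.ys_pos hV hy hv
    hq hcount
    (fun t ht hl => hφ.2.1 _ (by rw [← hstate t ht] at hl; linarith))
    (fun t ht hl => hφ.1 _ (by rw [← hstate t ht] at hl; linarith))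
  rw [cost_eq_playerCost (fun _ _ => rfl) hstate]
  exact hver

end ContentGame

theorem mainTheorem2 (N : ℕ) (hN : 1 ≤ N) (lam gam p umin umax : ℝ)
    (hlam : 0 < lam) (hgam : 0 < gam) (hp : 0 < p) (humin : 1 ≤ umin) (hu : umin < umax)
    (hcond : 0 < lam * (1 - lam * umin / (p + N * lam * umin)) - gam)
    (xstar : ℝ)
    (hxstar : xstar =
      1 - gam * (p + N * lam * umin) / (lam * (p + ((N : ℝ) - 1) * lam * umin)))
    (z : Fin N → ℝ) (hz : ∀ i, 0 ≤ z i) (hz1 : ∑ i, z i ≤ 1)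
    (G : ContentGame N) (hG : G = ContentGame.identical N lam gam p umin umax z)
    (φ : ℝ → ℝ) (hφ : G.IsThresholdLaw xstar φ) :
    (0 < xstar ∧ xstar < 1) ∧
    (∃ (u : ℝ → ℝ) (x : Fin N → ℝ → ℝ),
      G.IsTrajectory (fun _ => u) x ∧
      (∀ t : ℝ, 0 ≤ t → u t = φ (ContentGame.total x t)) ∧
      G.IsNash (fun _ => u) ∧
      ∀ v : ℝ → ℝ, G.IsNash (fun _ => v) →
        ∀ t : ℝ, 0 ≤ t → ContinuousWithinAt u (Ici 0) t → ContinuousWithinAt v (Ici 0) t →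
          v t = u t) ∧
    G.IsFeedbackNash (fun _ => φ) := by
  have hn : (1 : ℝ) ≤ N := by exact_mod_cast hN
  have hn0 : (0 : ℝ) ≤ (N : ℝ) - 1 := by linarith
  have humin0 : 0 < umin := by linarith
  have hA : 0 < p + (N : ℝ) * lam * umin := by positivity
  have hB : 0 < p + ((N : ℝ) - 1) * lam * umin := by positivity
  have hys : 0 < 1 - xstar := by
    rw [hxstar, sub_sub_cancel]
    positivity
  have hx0 : 0 < xstar := by
    have h1 : lam * (1 - lam * umin / (p + N * lam * umin)) =
        lam * (p + ((N : ℝ) - 1) * lam * umin) / (p + N * lam * umin) := by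
      field_simp
      ring
    rw [h1, sub_pos, lt_div_iff₀ hA] at hcond
    rw [hxstar, sub_pos, div_lt_one (by positivity)]
    exact hcond
  have h : ThresholdSetting N lam gam p umin umax (1 - xstar) := by
    refine ⟨hn, hlam, hgam, hp, humin0, hu, hys, ?_⟩
    have hN0 : (N : ℝ) ≠ 0 := by linarith
    rw [hxstar, sub_sub_cancel, steadyFactor]
    field_simp
    ring
  subst hG
  rw [← sub_sub_cancel 1 xstar] at hφ
  have hy : 0 ≤ 1 - ∑ i, z i := by linarith
  refine ⟨⟨hx0, by linarith⟩, ?_, ?_⟩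
  · obtain ⟨u, hlaw, hnash⟩ := ContentGame.exists_isNash_of_thresholdLaw hN h hz1 hφ
    have i : Fin N := ⟨0, hN⟩
    have htame : ∀ w, (ContentGame.identical N lam gam p umin umax z).IsNash (fun _ => w) →
        IsTameControl umin umax w := fun w hw => ContentGame.isTameControl_of_mem_controls
      (G := ContentGame.identical N lam gam p umin umax z) humin0.le (hw.1 i)
    have hut := htame u hnash
    obtain ⟨x, hx⟩ := ContentGame.exists_isTrajectory_identical (gam := gam) (p := p)
      (umin := umin) (umax := umax) (w := fun _ => u) hlam.le hz1 (fun _ => hut.isTame)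
      fun _ t ht => humin0.le.trans (hut.mem t ht).1
    refine ⟨u, x, hx, fun t ht => ?_, hnash, fun v hv t ht huc hvc => ?_⟩
    · have h1 := ContentGame.one_sub_total_eq_deviationState (i := i) hx hut.isTame hut.isTame
        (fun _ _ => rfl) (fun _ _ _ _ => rfl) ht
      rw [hlaw t ht, ← h1, sub_sub_cancel]
    · have hvt := htame v hv
      have hue : ∀ᵐ s ∂volume.restrict (Ioi 0),
          u s = φ (1 - deviationState N lam (1 - ∑ i, z i) u u s) := by
        filter_upwards [ae_restrict_mem measurableSet_Ioi] with s hs using hlaw s (le_of_lt hs)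
      have hve := ContentGame.IsNash.ae_eq_thresholdLaw hN h hz1 hφ hv
      have hanti : Antitone φ := hφ.antitone hu.le
      refine eq_of_ae_eq_of_continuousWithinAt ?_ ht hvc huc
      filter_upwards [hue, hve, ae_restrict_mem measurableSet_Ioi] with s h1 h2 hs
      have hs0 : 0 ≤ s := le_of_lt hs
      rw [h1, h2, le_antisymm (h.state_le_state hy hut hvt hanti hue hve hs0)
        (h.state_le_state hy hvt hut hanti hve hue hs0)]
  · obtain ⟨c, al, m, K, hV⟩ := ContentGame.exists_isValueCoeff h
    intro u x hx hfol i w x' hx' hw hfol'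
    have h1 := (ContentGame.cost_of_opponents_follow hN h hz1 hφ hV hx (i := i)
      (fun j _ => hfol j) (Or.inr (hfol i))).2 (hfol i)
    rw [h1]
    exact (ContentGame.cost_of_opponents_follow hN h hz1 hφ hV hx' (i := i) hfol'
      (Or.inl (ContentGame.isTameControl_of_mem_controls
        (G := ContentGame.identical N lam gam p umin umax z) humin0.le hw))).1
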